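/- **Setting.** Let $\Sigma$ be a ranked alphabet (a set with an arity function $|\cdot|:\Sigma\to\mathbb N$). A nondeterministic Büchi tree automaton (NBTA) $\mathcal X=(X,\Sigma,\delta_{\mathcal X},I_{\mathcal X},\mathsf{Acc}_{\mathcal X})$ has a state set $X$, a transition function $\delta_{\mathcal X}:X\to\mathcal P(\coprod_{\sigma\in\Sigma}X^{|\sigma|})$, initial states $I_{\mathcal X}\subseteq X$ and accepting states $\mathsf{Acc}_{\mathcal X}\subseteq X$. Its language $L(\mathcal X)$ is the set of (possibly infinite) $\Sigma$-trees that carry a run of $\mathcal X$ whose root is labelled by an initial state and each of whose infinite branches visits $\mathsf{Acc}_{\mathcal X}$ infinitely often. For NBTAs $\mathcal X,\mathcal Y$ over the same $\Sigma$ put $X_1=X\setminus\mathsf{Acc}_{\mathcal X}$, $X_2=\mathsf{Acc}_{\mathcal X}$, $Y_1=Y\setminus\mathsf{Acc}_{\mathcal Y}$, $Y_2=\mathsf{Acc}_{\mathcal Y}$. For $U\subseteq X\times Y$ and $i,j\in\{1,2\}$ let $F_{ij}(U)$ be the set of $(x,y)\in X_i\times Y_j$ such that for every $(\sigma,x_1,\dots,x_{|\sigma|})\in\delta_{\mathcal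 X}(x)$ there is $(\sigma,y_1,\dots,y_{|\sigma|})\in\delta_{\mathcal Y}(y)$ with $(x_k,y_k)\in U$ for all $k$. Let $(u_1^{\mathrm{sol}},\dots,u_4^{\mathrm{sol}})$ be the solution of the system of equations $$u_1=_\nu F_{11}(U),\quad u_2=_\mu F_{21}(U),\quad u_3=_\nu F_{12}(U),\quad u_4=_\nu F_{22}(U),\qquad U=u_1\cup u_2\cup u_3\cup u_4,$$ with $u_1\subseteq X_1\times Y_1$, $u_2\subseteq X_2\times Y_1$, $u_3\subseteq X_1\times Y_2$, $u_4\subseteq X_2\times Y_2$; that is, the equations are solved in the order $1,2,3,4$, each for the greatest ($\nu$) or least ($\mu$) fixed point as a function of the later variables, which is substituted into the later equations, and the values are finally propagated back. A *fair simulation* from $\mathcal X$ to $\mathcal Y$ is a relation $R\subseteq X\times Y$ such that every $x\in I_{\mathcal X}$ has some $y\in I_{\mathcal Y}$ with $(x,y)\in R$, and $R\subseteq u_1^{\mathrm{sol}}\cup u_2^{\mathrm{sol}}\cup u_3^{\mathrm{sol}}\cup u_4^{\mathrm{sol}}$. The parity game $G_{\mathcal X,\mathcal Y}$ has the following positions.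 * $*$: Odd moves to some $x\in I_{\mathcal X}$; priority $0$. * $x\in X$: Even moves to some $(x,y)$ with $y\in I_{\mathcal Y}$; priority $0$. * $(x,y)\in X\times Y$: Odd moves to some $((\sigma,x_1,\dots,x_{|\sigma|}),y)$ with $(\sigma,x_1,\dots,x_{|\sigma|})\in\delta_{\mathcal X}(x)$; priority $0$ on $X_1\times Y_1$, $1$ on $X_2\times Y_1$, $2$ on $X\times Y_2$. * $((\sigma,x_1,\dots,x_{|\sigma|}),y)\in(\coprod_{\sigma\in\Sigma}X^{|\sigma|})\times Y$: Even moves to some $((x_1,y_1),\dots,(x_{|\sigma|},y_{|\sigma|}))$ with $(\sigma,y_1,\dots,y_{|\sigma|})\in\delta_{\mathcal Y}(y)$; priority $0$. * $(p_1,\dots,p_n)\in(X\times Y)^*$: Odd moves to some $p_i$; priority $0$. A player who has to move and cannot loses; an infinite play is won by Even if and only if the greatest priority occurring infinitely often in it is even. Even wins from a position if some strategy of Even (a function of the history of the play) wins against all strategies of Odd. **Proposition 3.13.** Let $\mathcal X$ and $\mathcal Y$ be NBTAs over the same ranked alphabet $\Sigma$ with finite state sets $X$ and $Y$. Then a fair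 simulation from $\mathcal X$ to $\mathcal Y$ exists if and only if player Even wins $G_{\mathcal X,\mathcal Y}$ from $*$; and if this is the case, then $L(\mathcal X)\subseteq L(\mathcal Y)$. Moreover, the following problem is decidable: given a finite ranked alphabet and two NBTAs over it with finite state sets (all given explicitly as finite lists), does a fair simulation from the first to the second exist? -/

import Mathlib

universe u v w

/-! ## Equational systems and their solutions -/

/-- The sign of an equation: least (`mu`) or greatest (`nu`) fixed point. -/
inductive FixedPointKind where
  | mu
  | nu

/-- An equational system `u_i =_{kind i} rhs i (u_0, …, u_{m-1})`, for `i < m`, over complete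
lattices `L 0, …, L (m-1)`, with monotone right-hand sides. The order of the equations matters. -/
structure EquationalSystem {m : ℕ} (L : Fin m → Type u) [∀ i, CompleteLattice (L i)] where
  kind : Fin m → FixedPointKind
  rhs : ∀ i, (∀ j, L j) →o L i

namespace EquationalSystem

variable {m : ℕ} {L : Fin m → Type u} [∀ i, CompleteLattice (L i)]

/-- Given the interim solution `g` of the equations before `i` (see `interim`), the function
`f‡_i (·, l_{i+1}, …)` obtained from the `i`-th right-hand side by substituting the
interim solution for the variables before `i`. -/
def reduced (E : EquationalSystem L) (g : (∀ j, L j) →o (∀ j, L j)) (i : Fin m)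
    (l : ∀ j, L j) : L i →o L i where
  toFun v := E.rhs i (g (Function.update l i v))
  monotone' _ _ h := (E.rhs i).mono (g.mono (update_le_update_iff.2
    ⟨h, fun _ _ => le_rfl⟩))

theorem reduced_mono (E : EquationalSystem L) (g : (∀ j, L j) →o (∀ j, L j)) (i : Fin m) :
    Monotone (E.reduced g i) := fun _ _ h _ =>
  (E.rhs i).mono (g.mono (update_le_update_iff.2 ⟨le_rfl, fun j _ => h j⟩))

/-- The solution of the `i`-th equation as a function of the later variables. -/
def solveAt (E : EquationalSystem L) (g : (∀ j, L j) →o (∀ j, L j)) (i : Fin m)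
    (l : ∀ j, L j) : L i :=
  match E.kind i with
  | FixedPointKind.mu => (E.reduced g i l).lfp
  | FixedPointKind.nu => (E.reduced g i l).gfp

theorem solveAt_mono (E : EquationalSystem L) (g : (∀ j, L j) →o (∀ j, L j)) (i : Fin m) :
    Monotone (E.solveAt g i) := by
  intro a b h
  unfold solveAt
  cases E.kind i
  · exact OrderHom.lfp.mono (E.reduced_mono g i h)
  · exact OrderHom.gfp.mono (E.reduced_mono g i h)

/-- The `k`-th interim solution: `interim k l` has the entries of `l` at the indices `≥ k`,
and at each index `j < k` the interim solution `l^{(k)}_j` of the first `k` equations, as a function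
of the entries of `l` at the indices `≥ k`. -/
def interim (E : EquationalSystem L) : (k : ℕ) → k ≤ m → ((∀ j, L j) →o (∀ j, L j))
  | 0, _ => OrderHom.id
  | k + 1, hk =>
    let g := E.interim k (Nat.le_of_succ_le hk)
    let i : Fin m := ⟨k, hk⟩
    { toFun := fun l => g (Function.update l i (E.solveAt g i l))
      monotone' := fun _ _ h => g.mono (update_le_update_iff.2
        ⟨E.solveAt_mono g i h, fun j _ => h j⟩) }

/-- The solution of an equational system. (All entries have been overwritten, so the
starting tuple `⊥` plays no role.) -/
def solution (E : EquationalSystem L) : ∀ j, L j := E.interim m le_rfl ⊥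

end EquationalSystem

/-! ## Trees over a ranked alphabet

A ranked alphabet is a type `S` of symbols with an arity function `ar : S → ℕ`. -/

/-- `∐_{σ ∈ S} X^{|σ|}`. -/
abbrev Branching {S : Type u} (ar : S → ℕ) (X : Type v) := (s : S) × (Fin (ar s) → X)

/-- A (possibly infinite) tree over a ranked alphabet; positions are words over `ℕ`. -/
structure RankedTree {S : Type u} (ar : S → ℕ) where
  dom : Set (List ℕ)
  nonempty : dom.Nonempty
  prefix_closed : ∀ (p : List ℕ) (i : ℕ), p ++ [i] ∈ dom → p ∈ dom
  lower_closed : ∀ (p : List ℕ) (i j : ℕ), p ++ [j] ∈ dom → i ≤ j → p ++ [i] ∈ dom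
  label : dom → S
  mem_iff_lt_arity : ∀ (p : dom) (i : ℕ), p.1 ++ [i] ∈ dom ↔ i < ar (label p)

namespace RankedTree

variable {S : Type u} {ar : S → ℕ}

theorem nil_mem (t : RankedTree ar) : [] ∈ t.dom := by
  obtain ⟨p, hp⟩ := t.nonempty
  induction p using List.reverseRecOn with
  | nil => exact hp
  | append_singleton p i ih => exact ih (t.prefix_closed p i hp)

/-- The root of a tree. -/
def root (t : RankedTree ar) : t.dom := ⟨[], t.nil_mem⟩

/-- The `i`-th child of a position. -/
def child (t : RankedTree ar) (p : t.dom) (i : Fin (ar (t.label p))) : t.dom :=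
  ⟨p.1 ++ [i.1], (t.mem_iff_lt_arity p i).2 i.2⟩

/-- The prefix of length `n` of an infinite sequence. -/
def initialSegment (π : ℕ → ℕ) (n : ℕ) : List ℕ := (List.range n).map π

/-- `π` is an infinite branch of `t`. -/
def IsInfiniteBranch (t : RankedTree ar) (π : ℕ → ℕ) : Prop :=
  ∀ n, initialSegment π n ∈ t.dom

end RankedTree

/-! ## Nondeterministic Büchi tree automata -/

/-- A nondeterministic Büchi tree automaton over the ranked alphabet `(S, ar)` with
state space `X`. -/
structure NBTA {S : Type u} (ar : S → ℕ) (X : Type v) where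
  δ : X → Set (Branching ar X)
  init : Set X
  acc : Set X

/-- A run of an automaton: a tree labelled in `S × X`, the arity of a label being that of its
`S`-component, compatible with the transitions and the initial states. -/
structure NBTA.Run {S : Type u} {ar : S → ℕ} {X : Type v} (A : NBTA ar X)
    extends RankedTree (fun q : S × X => ar q.1) where
  transition : ∀ p : dom,
    (⟨(label p).1, fun i => (label (toRankedTree.child p i)).2⟩ : Branching ar X)
      ∈ A.δ (label p).2
  root_init : (label toRankedTree.root).2 ∈ A.init

namespace NBTA

variable {S : Type u} {ar : S → ℕ} {X : Type v} {Y : Type w}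

/-- The tree of symbols of a run, obtained by deleting the states. -/
def Run.delSt {A : NBTA ar X} (ρ : A.Run) : RankedTree ar where
  dom := ρ.dom
  nonempty := ρ.nonempty
  prefix_closed := ρ.prefix_closed
  lower_closed := ρ.lower_closed
  label p := (ρ.label p).1
  mem_iff_lt_arity := ρ.mem_iff_lt_arity

/-- A run is accepting if every infinite branch visits accepting states infinitely often;
finite branches are always accepting. -/
def Run.IsAccepting {A : NBTA ar X} (ρ : A.Run) : Prop :=
  ∀ (π : ℕ → ℕ) (hπ : ρ.toRankedTree.IsInfiniteBranch π),
    {n : ℕ | (ρ.label ⟨RankedTree.initialSegment π n, hπ n⟩).2 ∈ A.acc}.Infinite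

/-- The Büchi language of an automaton. -/
def language (A : NBTA ar X) : Set (RankedTree ar) :=
  {t | ∃ ρ : A.Run, ρ.IsAccepting ∧ ρ.delSt = t}

/-! ### Fair simulation -/

/-- `part false` is the set `X₁` of non-accepting states, `part true` the set `X₂` of
accepting states. -/
def part (A : NBTA ar X) : Bool → Set X
  | false => A.accᶜ
  | true => A.acc

/-- `□_{A,i}`. -/
def box (A : NBTA ar X) (i : Bool) {Z : Type w} (T : Set (Branching ar X × Z)) :
    Set (A.part i × Z) :=
  {q | ∀ a ∈ A.δ q.1, (a, q.2) ∈ T}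

/-- `◇_{B,j}`. -/
def diamond (B : NBTA ar Y) (j : Bool) (T : Set (Branching ar X × Branching ar Y)) :
    Set (Branching ar X × B.part j) :=
  {q | ∃ b ∈ B.δ q.2, (q.1, b) ∈ T}

/-- `⋀_Σ`: pairs of equal symbols whose successor states are componentwise related. -/
def bigWedge (ar : S → ℕ) (U : Set (X × Y)) : Set (Branching ar X × Branching ar Y) :=
  {q | ∃ (s : S) (xs : Fin (ar s) → X) (ys : Fin (ar s) → Y),
    q = (⟨s, xs⟩, ⟨s, ys⟩) ∧ ∀ i, (xs i, ys i) ∈ U}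

/-- The variables `u₁, u₂, u₃, u₄` (indexed by `0, 1, 2, 3`) range over the subsets of
`X₁ × Y₁`, `X₂ × Y₁`, `X₁ × Y₂`, `X₂ × Y₂`: this is the index of the `X`-component. -/
def xPart : Fin 4 → Bool := ![false, true, false, true]

/-- The index of the `Y`-component, see `xPart`. -/
def yPart : Fin 4 → Bool := ![false, false, true, true]

/-- The lattice over which the `k`-th variable ranges. -/
abbrev SimLattice (A : NBTA ar X) (B : NBTA ar Y) (k : Fin 4) : Type (max v w) :=
  Set (A.part (xPart k) × B.part (yPart k))

/-- `u₁ ∪ u₂ ∪ u₃ ∪ u₄` as a subset of `X × Y`. -/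
def simUnion (A : NBTA ar X) (B : NBTA ar Y) (f : ∀ k, SimLattice A B k) : Set (X × Y) :=
  {q | ∃ k, ∃ r ∈ f k, q = (r.1.1, r.2.1)}

/-- The equational system `u₁ =_ν …, u₂ =_μ …, u₃ =_ν …, u₄ =_ν …` of fair simulation. -/
def simSystem (A : NBTA ar X) (B : NBTA ar Y) : EquationalSystem (SimLattice A B) where
  kind := ![FixedPointKind.nu, FixedPointKind.mu, FixedPointKind.nu, FixedPointKind.nu]
  rhs k :=
    { toFun := fun f => A.box (xPart k) (B.diamond (yPart k) (bigWedge ar (simUnion A B f)))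
      monotone' := by
        intro f g h q hq a ha
        obtain ⟨b, hb, s, xs, ys, he, hU⟩ := hq a ha
        refine ⟨b, hb, s, xs, ys, he, fun i => ?_⟩
        obtain ⟨j, r, hr, hq⟩ := hU i
        exact ⟨j, r, h j hr, hq⟩ }

/-- `R` is a fair simulation from `A` to `B`. -/
def IsFairSimulation (A : NBTA ar X) (B : NBTA ar Y) (R : Set (X × Y)) : Prop :=
  (∀ x ∈ A.init, ∃ y ∈ B.init, (x, y) ∈ R) ∧ R ⊆ simUnion A B (simSystem A B).solution

end NBTA

/-! ## Parity games -/

inductive Player where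
  | even
  | odd

/-- A parity game with positions `V` and priorities in `{0, …, d}`. -/
structure ParityGame (V : Type u) (d : ℕ) where
  owner : V → Player
  moves : V → Set V
  priority : V → Fin (d + 1)

namespace ParityGame

variable {V : Type u} {d : ℕ}

/-- `f` is a strategy for player `P`: it maps the history `h ++ [v]` of a play that has reached
a position `v` of `P` to a legal move, whenever there is one. -/
def IsStrategy (G : ParityGame V d) (P : Player) (f : List V → V) : Prop :=
  ∀ (h : List V) (v : V), G.owner v = P → (G.moves v).Nonempty → f (h ++ [v]) ∈ G.moves v

/-- The move prescribed by `f` (for Even) and `g` (for Odd) at the history `h`, of which `v` is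
the last position. -/
def next (G : ParityGame V d) (f g : List V → V) (h : List V) (v : V) : V :=
  match G.owner v with
  | Player.even => f h
  | Player.odd => g h

/-- After `n` moves from `v₀`: the history strictly before the current position, and the current
position. The play ends at the first position without a legal move; the later entries are not
part of it. -/
def state (G : ParityGame V d) (f g : List V → V) (v₀ : V) : ℕ → List V × V
  | 0 => ([], v₀)
  | n + 1 =>
    let c := G.state f g v₀ n
    (c.1 ++ [c.2], G.next f g (c.1 ++ [c.2]) c.2)

/-- The play from `v₀` determined by the two strategies. -/
def play (G : ParityGame V d) (f g : List V → V) (v₀ : V) (n : ℕ) : V := (G.state f g v₀ n).2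

/-- A play is won by Even if it is finite and Odd is the player who cannot move, or if it is
infinite and the greatest priority that occurs infinitely often is even. -/
def WonByEven (G : ParityGame V d) (r : ℕ → V) : Prop :=
  (∃ n, (∀ k < n, (G.moves (r k)).Nonempty) ∧ G.moves (r n) = ∅ ∧ G.owner (r n) = Player.odd) ∨
  ((∀ n, (G.moves (r n)).Nonempty) ∧
    ∃ p : Fin (d + 1), IsGreatest {q | {n | G.priority (r n) = q}.Infinite} p ∧ Even p.val)

/-- Even wins from `v₀`: some strategy of Even wins against every strategy of Odd. -/
def EvenWins (G : ParityGame V d) (v₀ : V) : Prop :=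
  ∃ f, G.IsStrategy Player.even f ∧
    ∀ g, G.IsStrategy Player.odd g → G.WonByEven (G.play f g v₀)

end ParityGame

namespace NBTA

/-- The positions of the fair simulation game. -/
inductive SimPosition {S : Type u} (ar : S → ℕ) (X : Type v) (Y : Type w) where
  | start : SimPosition ar X Y
  | state (x : X) : SimPosition ar X Y
  | pair (q : X × Y) : SimPosition ar X Y
  | trans (a : Branching ar X) (y : Y) : SimPosition ar X Y
  | tuple (l : List (X × Y)) : SimPosition ar X Y

variable {S : Type u} {ar : S → ℕ} {X : Type v} {Y : Type w}

open Classical in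
/-- The parity game `G_{A,B}`. -/
noncomputable def simGame (A : NBTA ar X) (B : NBTA ar Y) :
    ParityGame (SimPosition ar X Y) 2 where
  owner
    | SimPosition.start => Player.odd
    | SimPosition.state _ => Player.even
    | SimPosition.pair _ => Player.odd
    | SimPosition.trans _ _ => Player.even
    | SimPosition.tuple _ => Player.odd
  moves
    | SimPosition.start => {v | ∃ x ∈ A.init, v = SimPosition.state x}
    | SimPosition.state x => {v | ∃ y ∈ B.init, v = SimPosition.pair (x, y)}
    | SimPosition.pair q => {v | ∃ a ∈ A.δ q.1, v = SimPosition.trans a q.2}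
    | SimPosition.trans a y =>
        {v | ∃ ys : Fin (ar a.1) → Y, (⟨a.1, ys⟩ : Branching ar Y) ∈ B.δ y ∧
          v = SimPosition.tuple (List.ofFn fun i => (a.2 i, ys i))}
    | SimPosition.tuple l => {v | ∃ q ∈ l, v = SimPosition.pair q}
  priority
    | SimPosition.pair q => if q.2 ∈ B.acc then 2 else if q.1 ∈ A.acc then 1 else 0
    | _ => 0

/-! ## Finite automata as finite data, for decidability -/

/-- Finite data for an automaton: the number `n` of states (which are `0, …, n-1`), the list of
transitions (source, symbol, list of successors), the list of initial states, and the list of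
accepting states. -/
abbrev Code := ℕ × List (ℕ × ℕ × List ℕ) × List ℕ × List ℕ

/-- The automaton given by finite data, over the alphabet of the symbols `0, 1, …` whose arities
are listed in `ars`. Entries of the data that do not fit are ignored. -/
def ofCode (ars : List ℕ) (c : Code) : NBTA (fun s : Fin ars.length => ars.get s) (Fin c.1) where
  δ x := {a | (x.val, a.1.val, List.ofFn fun i => (a.2 i).val) ∈ c.2.1}
  init := {x | x.val ∈ c.2.2.1}
  acc := {x | x.val ∈ c.2.2.2}

end NBTA

/-! The bridge between the nested fixed points and the game is a rank. The only least fixed point,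
on pairs whose `A`-state accepts and whose `B`-state does not, is reached by iteration from below,
in at most |X|·|Y| steps since the state sets are finite. The index of an approximant serves as the
rank of a pair. Answering a challenge keeps the rank if neither state accepts, lowers it if only the
`A`-state accepts, and may reset it if the `B`-state accepts. A rank cannot fall forever, so along
any chain of answers infinitely many accepting `A`-states force infinitely many accepting `B`-states
(`Set.Infinite.of_rank`).

The ranked simulation obtained in this way (`IsFairSimulation.exists_rankedSimulation`) has three
uses. Following it wins the game for Even (`IsRankedSimulation.evenWins`). Answering an accepting
run of `A` node by node gives an accepting run of `B` on the same tree
(`IsRankedSimulation.language_subset`). With its ranks bounded it is a finite object, and the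
greatest one is found by repeatedly deleting triples that cannot answer, which is a primitive
recursive procedure (`primrecPred_codeCovers`).

For the way back from the game (`exists_isFairSimulation_of_evenWins`), take the pairs reachable
under a winning strategy of Even. By the coinduction principle `subset_simUnion_solution` it
suffices to show that they lie in every set with the closure properties of the fixed points. A
reachable pair outside such a set would let Odd pass through infinitely many positions of priority 1
without ever meeting priority 2. This direction needs no finiteness. -/

namespace EquationalSystem

/-! ### Interim solutions of equational systems -/

variable {m : ℕ} {L : Fin m → Type u} [∀ i, CompleteLattice (L i)]

theorem solveAt_eq_reduced (E : EquationalSystem L) (g : (∀ j, L j) →o (∀ j, L j)) (i : Fin m)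
    (l : ∀ j, L j) : E.reduced g i l (E.solveAt g i l) = E.solveAt g i l := by
  unfold solveAt
  cases E.kind i
  · exact OrderHom.map_lfp _
  · exact OrderHom.map_gfp _

theorem interim_succ (E : EquationalSystem L) (k : ℕ) (hk : k + 1 ≤ m) (l : ∀ j, L j) :
    E.interim (k + 1) hk l = E.interim k (Nat.le_of_succ_le hk) (Function.update l ⟨k, hk⟩
      (E.solveAt (E.interim k (Nat.le_of_succ_le hk)) ⟨k, hk⟩ l)) := rfl

theorem interim_apply_of_le (E : EquationalSystem L) (k : ℕ) (hk : k ≤ m) (l : ∀ j, L j)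
    (j : Fin m) (hj : k ≤ j) : E.interim k hk l j = l j := by
  induction k generalizing l with
  | zero => rfl
  | succ k ih =>
    rw [interim_succ, ih _ _ (by omega), Function.update_of_ne]
    rintro rfl
    simp at hj

theorem interim_apply_of_lt (E : EquationalSystem L) (k : ℕ) (hk : k ≤ m) (l : ∀ j, L j)
    (j : Fin m) (hj : j < k) : E.interim k hk l j = E.rhs j (E.interim k hk l) := by
  induction k generalizing l with
  | zero => omega
  | succ k ih =>
    rw [interim_succ]
    rcases Nat.lt_succ_iff_lt_or_eq.1 hj with h | h
    · exact ih _ _ h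
    · obtain rfl : j = ⟨k, hk⟩ := Fin.ext h
      rw [E.interim_apply_of_le k _ _ ⟨k, hk⟩ le_rfl, Function.update_self]
      exact (E.solveAt_eq_reduced _ _ _).symm

theorem interim_congr (E : EquationalSystem L) (k : ℕ) (hk : k ≤ m) {l l' : ∀ j, L j}
    (h : ∀ j : Fin m, k ≤ j → l j = l' j) : E.interim k hk l = E.interim k hk l' := by
  induction k generalizing l l' with
  | zero => exact congrArg _ (funext fun j => h j (Nat.zero_le _))
  | succ k ih =>
    rw [interim_succ, interim_succ]
    have key : ∀ w, E.interim k (Nat.le_of_succ_le hk) (Function.update l ⟨k, hk⟩ w) =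
        E.interim k (Nat.le_of_succ_le hk) (Function.update l' ⟨k, hk⟩ w) := by
      intro w
      apply ih
      intro j hj
      by_cases hjk : j = ⟨k, hk⟩
      · subst hjk; simp
      · rw [Function.update_of_ne hjk, Function.update_of_ne hjk]
        refine h j ?_
        have : (j : ℕ) ≠ k := fun e => hjk (Fin.ext e)
        omega
    have hr : E.reduced (E.interim k (Nat.le_of_succ_le hk)) ⟨k, hk⟩ l =
        E.reduced (E.interim k (Nat.le_of_succ_le hk)) ⟨k, hk⟩ l' :=
      OrderHom.ext _ _ (funext fun w => congrArg (E.rhs ⟨k, hk⟩) (key w))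
    rw [key]
    unfold solveAt
    rw [hr]

/-- A post-fixed point lies below the greatest fixed point, so solving one more `nu` equation can
only enlarge a tuple whose entry there is already post-fixed. This carries a coinductive candidate
through the last equations. -/
theorem interim_le_interim_succ (E : EquationalSystem L) (k : ℕ) (hk : k + 1 ≤ m)
    (hnu : E.kind ⟨k, hk⟩ = FixedPointKind.nu) {l : ∀ j, L j}
    (h : l ⟨k, hk⟩ ≤ E.rhs ⟨k, hk⟩ (E.interim k (Nat.le_of_succ_le hk) l)) :
    E.interim k (Nat.le_of_succ_le hk) l ≤ E.interim (k + 1) hk l := by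
  rw [interim_succ]
  refine (E.interim k _).mono (le_update_iff.2 ⟨?_, fun j _ => le_rfl⟩)
  unfold solveAt
  rw [hnu]
  refine OrderHom.le_gfp _ ?_
  show l ⟨k, hk⟩ ≤ E.rhs ⟨k, hk⟩ (E.interim k _ (Function.update l ⟨k, hk⟩ (l ⟨k, hk⟩)))
  rwa [Function.update_eq_self]

theorem solution_apply (E : EquationalSystem L) (k : Fin m) :
    E.solution k = E.rhs k E.solution :=
  E.interim_apply_of_lt m le_rfl ⊥ k k.2

/-- All entries get overwritten, so the tuple one starts from is free; the coinduction below starts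
from a candidate relation instead of `⊥`. -/
theorem interim_eq_solution (E : EquationalSystem L) (l : ∀ j, L j) :
    E.interim m le_rfl l = E.solution :=
  E.interim_congr m le_rfl fun j hj => absurd j.2 (by omega)

end EquationalSystem

/-- The least fixed point of a monotone operator on the subsets of a set with at most `N` elements
is reached after `N` iterations from below. -/
theorem OrderHom.iterate_bot_eq_lfp_of_card_le {α : Type u} [Finite α] (G : Set α →o Set α) {N : ℕ}
    (hN : Nat.card α ≤ N) : G^[N] ⊥ = G.lfp := by
  have hmono : ∀ n, G^[n] ⊥ ≤ G^[n + 1] ⊥ := by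
    intro n
    rw [Function.iterate_succ_apply]
    exact G.mono.iterate n bot_le
  have hle : ∀ n, G^[n] ⊥ ≤ G.lfp := by
    intro n
    induction n with
    | zero => exact bot_le
    | succ n ih =>
      rw [Function.iterate_succ_apply', ← G.map_lfp]
      exact G.mono ih
  have hstab : ∃ n ≤ N, G^[n + 1] ⊥ = G^[n] ⊥ := by
    by_contra! hne
    -- Without stabilisation the first `N + 1` inclusions are strict, and each adds an element: too
    -- many for a set of size `N`.
    have hcard : ∀ n ≤ N + 1, n ≤ (G^[n] ⊥).ncard := by
      intro n hn
      induction n with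
      | zero => exact Nat.zero_le _
      | succ n ih =>
        have := Set.ncard_lt_ncard
          ((hmono n).lt_of_ne (hne n (by omega)).symm) (Set.toFinite _)
        have := ih (by omega)
        omega
    have h1 := hcard (N + 1) le_rfl
    have h2 := Set.ncard_le_card (G^[N + 1] ⊥)
    omega
  obtain ⟨n, hn, hfix⟩ := hstab
  refine le_antisymm (hle N) ?_
  have h1 : G.lfp ≤ G^[n] ⊥ := by
    refine G.lfp_le ?_
    rw [← Function.iterate_succ_apply' (f := G)]
    exact hfix.le
  exact h1.trans (monotone_nat_of_le_succ hmono hn)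

/-! ### Fair simulation: ranks from the solution, and coinduction into it -/

namespace NBTA

variable {S : Type u} {ar : S → ℕ} {X : Type v} {Y : Type w}

/-- The pairs all of whose challenges in `A` can be answered in `B` with successors in `U`. -/
def simStep (A : NBTA ar X) (B : NBTA ar Y) (U : Set (X × Y)) : Set (X × Y) :=
  {q | ∀ a ∈ A.δ q.1, ∃ ys : Fin (ar a.1) → Y,
    (⟨a.1, ys⟩ : Branching ar Y) ∈ B.δ q.2 ∧ ∀ i, (a.2 i, ys i) ∈ U}

theorem simStep_mono (A : NBTA ar X) (B : NBTA ar Y) : Monotone (simStep A B) := by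
  intro U V h q hq a ha
  obtain ⟨ys, hys, hU⟩ := hq a ha
  exact ⟨ys, hys, fun i => h (hU i)⟩

theorem simUnion_mono (A : NBTA ar X) (B : NBTA ar Y) : Monotone (simUnion A B) := by
  rintro f g h q ⟨k, r, hr, hq⟩
  exact ⟨k, r, h k hr, hq⟩

theorem mem_simSystem_rhs (A : NBTA ar X) (B : NBTA ar Y) (f : ∀ k, SimLattice A B k) (k : Fin 4)
    (r : A.part (xPart k) × B.part (yPart k)) :
    r ∈ (simSystem A B).rhs k f ↔ ((r.1 : X), (r.2 : Y)) ∈ simStep A B (simUnion A B f) := by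
  constructor
  · intro h a ha
    obtain ⟨b, hb, s, xs, ys, he, hU⟩ := h a ha
    obtain ⟨rfl, rfl⟩ := Prod.mk.inj he
    exact ⟨ys, hb, hU⟩
  · intro h a ha
    obtain ⟨ys, hb, hU⟩ := h a ha
    exact ⟨⟨a.1, ys⟩, hb, a.1, a.2, ys, rfl, hU⟩

/-- The `k`-th part of a relation. -/
def restrictPart (A : NBTA ar X) (B : NBTA ar Y) (W : Set (X × Y)) (k : Fin 4) :
    SimLattice A B k := {r | ((r.1 : X), (r.2 : Y)) ∈ W}

theorem mem_simUnion_iff (A : NBTA ar X) (B : NBTA ar Y) (f : ∀ k, SimLattice A B k)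
    (q : X × Y) : q ∈ simUnion A B f ↔
      ∃ (k : Fin 4) (hx : q.1 ∈ A.part (xPart k)) (hy : q.2 ∈ B.part (yPart k)),
        ((⟨q.1, hx⟩, ⟨q.2, hy⟩) : A.part (xPart k) × B.part (yPart k)) ∈ f k := by
  constructor
  · rintro ⟨k, r, hr, rfl⟩
    exact ⟨k, r.1.2, r.2.2, hr⟩
  · rintro ⟨k, hx, hy, h⟩
    exact ⟨k, _, h, rfl⟩

/-- A relation with ranks that witnesses fair simulation: the rank does not increase outside the
accepting states of `B`, and decreases at the accepting states of `A`. -/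
structure IsRankedSimulation (A : NBTA ar X) (B : NBTA ar Y) (T : Set ((X × Y) × ℕ)) : Prop where
  step : ∀ q n, (q, n) ∈ T → q ∈ simStep A B
    {p | ∃ k, (p, k) ∈ T ∧ (q.2 ∈ B.acc ∨ (k ≤ n ∧ (q.1 ∈ A.acc → k < n)))}
  covers : ∀ x ∈ A.init, ∃ y ∈ B.init, ∃ n, ((x, y), n) ∈ T

/-- The third and fourth variables are frozen at their final values, the second runs through the
iterates of its least fixed point, and the first is re-solved for each iterate. The second variable
ranges over subsets of a set with at most |X|·|Y| elements, so that many iterations reach the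
solution. -/
theorem exists_approximants [Finite X] [Finite Y] (A : NBTA ar X) (B : NBTA ar Y) :
    ∃ M : ℕ → ∀ k, SimLattice A B k,
      M (Nat.card X * Nat.card Y) = (simSystem A B).solution ∧
      (∀ n, M n 0 = (simSystem A B).rhs 0 (M n)) ∧
      M 0 1 = ∅ ∧ (∀ n, M (n + 1) 1 = (simSystem A B).rhs 1 (M n)) ∧
      (∀ n, M n 2 = (simSystem A B).solution 2) ∧ ∀ n, M n 3 = (simSystem A B).solution 3 := by
  set E := simSystem A B
  obtain ⟨l, hl⟩ : ∃ l, E.solution = E.interim 2 (by omega) l := ⟨_, rfl⟩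
  set g := E.interim 1 (by omega) with hg
  set G := E.reduced g 1 l with hG
  have hsol : E.solution = g (Function.update l 1 G.lfp) := hl
  have hcard : Nat.card (A.part (xPart 1) × B.part (yPart 1)) ≤ Nat.card X * Nat.card Y := by
    rw [Nat.card_prod]
    exact Nat.mul_le_mul (Nat.card_le_card_of_injective _ Subtype.val_injective)
      (Nat.card_le_card_of_injective _ Subtype.val_injective)
  have hap : ∀ l' (j : Fin 4), 1 ≤ j.val → g l' j = l' j := fun l' j hj =>
    E.interim_apply_of_le 1 (by omega) l' j hj
  refine ⟨fun n => g (Function.update l 1 (G^[n] ⊥)), ?_, ?_, ?_, ?_, ?_, ?_⟩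
  · show g (Function.update l 1 (G^[_] ⊥)) = _
    rw [hsol, G.iterate_bot_eq_lfp_of_card_le hcard]
  · exact fun n => E.interim_apply_of_lt 1 (by omega) _ 0 (by decide)
  · show g (Function.update l 1 (G^[0] ⊥)) 1 = ∅
    rw [hap _ _ (by decide), Function.update_self]
    rfl
  · intro n
    show g (Function.update l 1 (G^[n + 1] ⊥)) 1 = _
    rw [hap _ _ (by decide), Function.update_self, Function.iterate_succ_apply']
    rfl
  · intro n
    show g (Function.update l 1 (G^[n] ⊥)) 2 = _
    rw [hsol, hap _ _ (by decide), hap _ _ (by decide)]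
    rfl
  · intro n
    show g (Function.update l 1 (G^[n] ⊥)) 3 = _
    rw [hsol, hap _ _ (by decide), hap _ _ (by decide)]
    rfl

/-- A pair receives every rank `n ≤ N` whose approximant contains it. The first equation answers
within the same approximant and the second within the previous one. The last two are evaluated at
the full solution, so there the rank jumps back to `N`; this is allowed because the `B`-state
accepts. -/
theorem IsFairSimulation.exists_rankedSimulation [Finite X] [Finite Y] {A : NBTA ar X}
    {B : NBTA ar Y} {R : Set (X × Y)} (hR : IsFairSimulation A B R) :
    ∃ T : Set ((X × Y) × ℕ), IsRankedSimulation A B T ∧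
      ∀ p ∈ T, p.2 ≤ Nat.card X * Nat.card Y := by
  obtain ⟨M, hsol, h0, h10, h1, h2, h3⟩ := exists_approximants A B
  set N := Nat.card X * Nat.card Y
  refine ⟨{p | p.2 ≤ N ∧ p.1 ∈ simUnion A B (M p.2)}, ⟨?_, ?_⟩, fun p hp => hp.1⟩
  · rintro q n ⟨hn, k, r, hr, rfl⟩
    have hn : n ≤ N := hn
    have hr : r ∈ M n k := hr
    have hacc : ∀ f, r ∈ (simSystem A B).rhs k f → f = (simSystem A B).solution →
        (r.2 : Y) ∈ B.acc → ((r.1 : X), (r.2 : Y)) ∈ simStep A B {p | ∃ k,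
          (p, k) ∈ {p : (X × Y) × ℕ | p.2 ≤ N ∧ p.1 ∈ simUnion A B (M p.2)} ∧
          ((r.2 : Y) ∈ B.acc ∨ (k ≤ n ∧ ((r.1 : X) ∈ A.acc → k < n)))} := by
      rintro f hf rfl hy
      refine simStep_mono A B ?_ ((mem_simSystem_rhs A B _ _ _).1 hf)
      intro p hp
      exact ⟨N, ⟨le_rfl, by rwa [hsol]⟩, Or.inl hy⟩
    fin_cases k
    · have hr' : r ∈ M n 0 := hr
      rw [h0] at hr'
      refine simStep_mono A B ?_ ((mem_simSystem_rhs A B _ _ _).1 hr')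
      intro p hp
      exact ⟨n, ⟨hn, hp⟩, Or.inr ⟨le_rfl, fun hx => absurd hx r.1.2⟩⟩
    · have hr' : r ∈ M n 1 := hr
      cases n with
      | zero => rw [h10] at hr'; exact hr'.elim
      | succ n =>
        rw [h1] at hr'
        refine simStep_mono A B ?_ ((mem_simSystem_rhs A B _ _ _).1 hr')
        intro p hp
        exact ⟨n, ⟨by show n ≤ N; omega, hp⟩, Or.inr ⟨by omega, fun _ => by omega⟩⟩
    · have hr' : r ∈ M n 2 := hr
      rw [h2, EquationalSystem.solution_apply] at hr'
      exact hacc _ hr' rfl r.2.2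
    · have hr' : r ∈ M n 3 := hr
      rw [h3, EquationalSystem.solution_apply] at hr'
      exact hacc _ hr' rfl r.2.2
  · intro x hx
    obtain ⟨y, hy, hxy⟩ := hR.1 x hx
    exact ⟨y, hy, N, le_rfl, by rw [hsol]; exact hR.2 hxy⟩

/-- A coinduction principle for the solution of the system of fair simulation. -/
theorem subset_simUnion_solution (A : NBTA ar X) (B : NBTA ar Y) (W : Set (X × Y))
    (hstep : W ⊆ simStep A B W)
    (h : ∀ U : Set (X × Y), (∀ q ∈ W, q.2 ∈ B.acc → q ∈ U) →
      (∀ q ∈ simStep A B U, q.1 ∈ A.acc → q.2 ∉ B.acc → q ∈ U) →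
      (∀ V : Set (X × Y), (∀ q ∈ V, q.1 ∉ A.acc ∧ q.2 ∉ B.acc) → V ⊆ simStep A B (U ∪ V) →
        V ⊆ U) → W ⊆ U) :
    W ⊆ simUnion A B (simSystem A B).solution := by
  set E := simSystem A B
  set l := restrictPart A B W with hl
  set M := E.interim 2 (by omega) l with hM
  have hM2 : M 2 = l 2 := E.interim_apply_of_le 2 (by omega) l 2 (by decide)
  have hM3 : M 3 = l 3 := E.interim_apply_of_le 2 (by omega) l 3 (by decide)
  have hM1 : M 1 = E.rhs 1 M := E.interim_apply_of_lt 2 (by omega) l 1 (by decide)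
  -- No equation precedes the first, so `M 0` is the greatest fixed point of its right-hand side
  -- with the other entries of `M` held fixed.
  have hM0 : ∀ V, V ≤ E.rhs 0 (Function.update M 0 V) → V ≤ M 0 := by
    intro V hV
    obtain ⟨l', hl'⟩ : ∃ l', M = Function.update l' 0
      (E.reduced OrderHom.id 0 l').gfp := ⟨_, rfl⟩
    have : Function.update M 0 V = Function.update l' 0 V := by rw [hl', Function.update_idem]
    rw [this] at hV
    have h0 : M 0 = (E.reduced OrderHom.id 0 l').gfp := by rw [hl', Function.update_self]
    rw [h0]
    exact OrderHom.le_gfp _ hV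
  -- The set tested is the one obtained by solving the first two equations with the last two
  -- variables set to the parts of `W`. Of the second entry only the fixed point equation is used;
  -- leastness is already encoded in the quantification over all `U`.
  have hWM : W ⊆ simUnion A B M := by
    apply h
    · intro q hq hy
      rw [mem_simUnion_iff]
      by_cases hx : q.1 ∈ A.acc
      · exact ⟨3, hx, hy, by rw [hM3]; exact hq⟩
      · exact ⟨2, hx, hy, by rw [hM2]; exact hq⟩
    · intro q hq hx hy
      rw [mem_simUnion_iff]
      exact ⟨1, hx, hy, by rw [hM1]; exact (mem_simSystem_rhs A B _ _ _).2 hq⟩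
    · intro V hV hVs q hq
      rw [mem_simUnion_iff]
      refine ⟨0, (hV q hq).1, (hV q hq).2, ?_⟩
      -- `V` answers into `U ∪ V`, so it becomes post-fixed only after joining it with the part `M
      -- 0` of `U`.
      have hle : restrictPart A B V 0 ⊔ M 0 ≤ M 0 := by
        apply hM0
        have hsub : simUnion A B M ∪ V ⊆
            simUnion A B (Function.update M 0 (restrictPart A B V 0 ⊔ M 0)) := by
          rintro p (hp | hp)
          · exact simUnion_mono A B (le_update_iff.2 ⟨le_sup_right, fun j _ => le_rfl⟩) hp
          · rw [mem_simUnion_iff]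
            refine ⟨0, (hV p hp).1, (hV p hp).2, ?_⟩
            rw [Function.update_self]
            exact Or.inl hp
        refine sup_le ?_ ?_
        · intro r hr
          exact (mem_simSystem_rhs A B _ _ _).2 (simStep_mono A B hsub (hVs hr))
        · refine (E.interim_apply_of_lt 2 (by omega) l 0 (by decide)).le.trans ?_
          exact (E.rhs 0).mono (le_update_iff.2 ⟨le_sup_right, fun j _ => le_rfl⟩)
      exact hle (Or.inl hq)
  -- Since `W` answers into itself and lies in the union of `M`, its parts are post-fixed for the
  -- remaining `nu` equations, and solving these only enlarges `M`.
  have hrhs : ∀ k, l k ≤ E.rhs k M := fun k r hr =>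
    (mem_simSystem_rhs A B _ _ _).2 (simStep_mono A B hWM (hstep hr))
  have h23 : M ≤ E.interim 3 (by omega) l :=
    E.interim_le_interim_succ 2 (by omega) rfl (hrhs 2)
  have h34 : E.interim 3 (by omega) l ≤ E.interim 4 le_rfl l :=
    E.interim_le_interim_succ 3 (by omega) rfl ((hrhs 3).trans ((E.rhs 3).mono h23))
  rw [← E.interim_eq_solution l]
  exact hWM.trans (simUnion_mono A B (h23.trans h34))

end NBTA

/-! ### Combinatorics of infinite chains -/

/-- If `rk` does not increase outside `Q` and decreases at `P` outside `Q`, then `Q` recurs if `P`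
does. -/
theorem Set.Infinite.of_rank {P Q : ℕ → Prop} (rk : ℕ → ℕ)
    (h : ∀ k, Q k ∨ (rk (k + 1) ≤ rk k ∧ (P k → rk (k + 1) < rk k)))
    (hP : {k | P k}.Infinite) : {k | Q k}.Infinite := by
  by_contra hQ
  obtain ⟨K, hK⟩ := (Set.not_infinite.1 hQ).bddAbove
  have hn : ∀ k, K < k → rk (k + 1) ≤ rk k ∧ (P k → rk (k + 1) < rk k) := fun k hk =>
    (h k).resolve_left fun hq => absurd (hK hq) (by omega)
  have hanti : ∀ k, K < k → ∀ j, rk (k + j) ≤ rk k := by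
    intro k hk j
    induction j with
    | zero => exact le_rfl
    | succ j ih => exact (hn (k + j) (by omega)).1.trans ih
  have : ∀ r k, K < k → rk k ≤ r → False := by
    intro r
    induction r using Nat.strong_induction_on with
    | _ r ih =>
      intro k hk hr
      obtain ⟨k', hk', hlt⟩ := hP.exists_gt k
      have h1 := (hn k' (by omega)).2 hk'
      have h2 := hanti k hk (k' - k)
      rw [Nat.add_sub_cancel' hlt.le] at h2
      exact ih (rk (k' + 1)) (by omega) (k' + 1) (by omega) le_rfl
  exact this _ (K + 1) (by omega) le_rfl

/-- If every element of `Q` leads in at least one step to another element of `Q`, then there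
is an infinite chain that meets `Q` infinitely often. -/
theorem exists_chain_of_transGen {α : Type u} {r : α → α → Prop} {Q : α → Prop}
    (h : ∀ s, Q s → ∃ s', Q s' ∧ Relation.TransGen r s s') {s₀ : α} (h₀ : Q s₀) :
    ∃ c : ℕ → α, c 0 = s₀ ∧ (∀ n, r (c n) (c (n + 1))) ∧ {n | Q (c n)}.Infinite := by
  -- `D n s`: from `s` some element of `Q` is reached in exactly `n` steps. The chain carries `n` as
  -- a countdown, restarted from `hD` whenever it hits zero, and at zero the current element lies in
  -- `Q`.
  let D : ℕ → α → Prop := fun n => Nat.rec Q (fun _ D s => ∃ s', r s s' ∧ D s') n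
  have hD : ∀ s, Q s → ∃ n, D (n + 1) s := by
    intro s hs
    obtain ⟨s', hs', ht⟩ := h s hs
    clear hs
    induction ht using Relation.TransGen.head_induction_on with
    | single hr => exact ⟨0, _, hr, hs'⟩
    | head hr _ ih =>
      obtain ⟨n, hn⟩ := ih
      exact ⟨n + 1, _, hr, hn⟩
  have hnext : ∀ b : {p : ℕ × α // D p.1 p.2}, ∃ b' : {p : ℕ × α // D p.1 p.2},
      r b.1.2 b'.1.2 ∧ (b.1.1 = 0 ∨ b'.1.1 + 1 = b.1.1) := by
    rintro ⟨⟨n, s⟩, hs⟩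
    cases n with
    | zero =>
      obtain ⟨n, s', hr, hs'⟩ := hD s hs
      exact ⟨⟨(n, s'), hs'⟩, hr, Or.inl rfl⟩
    | succ n =>
      obtain ⟨s', hr, hs'⟩ := hs
      exact ⟨⟨(n, s'), hs'⟩, hr, Or.inr rfl⟩
  choose nxt hnxt using hnext
  let c : ℕ → {p : ℕ × α // D p.1 p.2} := fun n => nxt^[n] ⟨(0, s₀), h₀⟩
  have hc : ∀ n, c (n + 1) = nxt (c n) := fun n => Function.iterate_succ_apply' _ _ _
  refine ⟨fun n => (c n).1.2, rfl, fun n => ?_, ?_⟩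
  · show r (c n).1.2 (c (n + 1)).1.2
    rw [hc]
    exact (hnxt (c n)).1
  · rw [Set.infinite_iff_exists_gt]
    intro a
    have : ∀ k n, (c n).1.1 = k → ∃ m ≥ n, (c m).1.1 = 0 := by
      intro k
      induction k with
      | zero => exact fun n hn => ⟨n, le_rfl, hn⟩
      | succ k ih =>
        intro n hn
        obtain ⟨m, hm, h0⟩ := ih (n + 1) (by
          have := (hnxt (c n)).2
          rw [← hc] at this
          omega)
        exact ⟨m, by omega, h0⟩
    obtain ⟨m, hm, h0⟩ := this _ (a + 1) rfl
    refine ⟨m, ?_, by omega⟩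
    have := (c m).2
    rw [h0] at this
    exact this

/-! ### Strategies and plays in parity games -/

namespace ParityGame

variable {V : Type u} {d : ℕ}

/-- Turns a partial, multivalued recipe `M` of legal moves into a total strategy: follow `M` where
it prescribes something, otherwise make any legal move. -/
theorem exists_legal_function [Nonempty V] (G : ParityGame V d) (M : List V → V → Prop)
    (hM : ∀ h v w, M (h ++ [v]) w → w ∈ G.moves v) :
    ∃ f : List V → V, (∀ P, G.IsStrategy P f) ∧ ∀ l w, M l w → M l (f l) := by
  have : ∀ l, ∃ w, (∀ h v, l = h ++ [v] → (G.moves v).Nonempty → w ∈ G.moves v) ∧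
      ∀ w', M l w' → M l w := by
    intro l
    by_cases h : ∃ w, M l w
    · obtain ⟨w, hw⟩ := h
      refine ⟨w, ?_, fun _ _ => hw⟩
      rintro h v rfl -
      exact hM h v w hw
    · rcases l.eq_nil_or_concat with rfl | ⟨l, v, rfl⟩
      · exact ⟨Classical.arbitrary V, by simp, fun w' hw' => absurd ⟨w', hw'⟩ h⟩
      · by_cases hv : (G.moves v).Nonempty
        · obtain ⟨w, hw⟩ := hv
          refine ⟨w, fun h' v' he _ => ?_, fun w' hw' => absurd ⟨w', hw'⟩ h⟩
          simp at he
          rwa [← he.2]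
        · refine ⟨Classical.arbitrary V, fun h' v' he hne => ?_, fun w' hw' => absurd ⟨w', hw'⟩ h⟩
          simp at he
          exact absurd (he.2 ▸ hne) hv
  choose f hf using this
  exact ⟨f, fun P h v _ hne => (hf _).1 h v rfl hne, fun l w hw => (hf l).2 w hw⟩

theorem state_succ (G : ParityGame V d) (f g : List V → V) (v₀ : V) (n : ℕ) :
    G.state f g v₀ (n + 1) = ((G.state f g v₀ n).1 ++ [(G.state f g v₀ n).2],
      G.next f g ((G.state f g v₀ n).1 ++ [(G.state f g v₀ n).2]) (G.state f g v₀ n).2) := rfl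

/-- A legal move, from a history to a longer one, that respects the strategy `f` of Even. -/
def ConsistentStep (G : ParityGame V d) (f : List V → V) (a b : List V × V) : Prop :=
  b.2 ∈ G.moves a.2 ∧ (G.owner a.2 = Player.even → b.2 = f (a.1 ++ [a.2])) ∧ b.1 = a.1 ++ [a.2]

/-- Odd can replay any play consistent with `f` by looking only at the length of the history. The
history ends with the current position, so at time `n` its length is `n + 1`, the index of the next
position of `c`. -/
theorem exists_strategy_of_consistent (G : ParityGame V d) (f : List V → V)
    (c : ℕ → List V × V) {v₀ : V} (h₀ : c 0 = ([], v₀)) :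
    ∃ g, G.IsStrategy Player.odd g ∧
      ∀ n, (∀ k < n, G.ConsistentStep f (c k) (c (k + 1))) → G.state f g v₀ n = c n := by
  have : Nonempty V := ⟨v₀⟩
  obtain ⟨g, hg, hgc⟩ := G.exists_legal_function
    (fun l w => ∃ h v, l = h ++ [v] ∧ w ∈ G.moves v ∧ w = (c l.length).2) (by
      rintro h v w ⟨h', v', he, hw, -⟩
      simp at he
      rwa [he.2])
  refine ⟨g, hg _, fun n hn => ?_⟩
  have : G.state f g v₀ n = c n ∧ (c n).1.length = n := by
    induction n with
    | zero => rw [h₀]; exact ⟨rfl, rfl⟩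
    | succ n ih =>
      obtain ⟨ih, hlen⟩ := ih fun k hk => hn k (by omega)
      obtain ⟨h1, h2, h3⟩ := hn n (by omega)
      refine ⟨?_, by rw [h3]; simp [hlen]⟩
      rw [state_succ, ih]
      refine Prod.ext h3.symm ?_
      show G.next f g _ _ = _
      unfold next
      cases ho : G.owner (c n).2 with
      | even => exact (h2 ho).symm
      | odd =>
        obtain ⟨h, v, -, -, hw⟩ := hgc ((c n).1 ++ [(c n).2]) (c (n + 1)).2
          ⟨_, _, rfl, h1, by simp [hlen]⟩
        show g _ = _
        rw [hw]
        simp [hlen]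
  exact this.1

theorem exists_consistent_of_reflTransGen (G : ParityGame V d) {f : List V → V}
    {a b : List V × V} (h : Relation.ReflTransGen (G.ConsistentStep f) a b) :
    ∃ (c : ℕ → List V × V) (n : ℕ), c 0 = a ∧ c n = b ∧
      ∀ k < n, G.ConsistentStep f (c k) (c (k + 1)) := by
  induction h with
  | refl => exact ⟨fun _ => a, 0, rfl, rfl, fun k hk => absurd hk (by omega)⟩
  | @tail _ b' _ hbc ih =>
    obtain ⟨c, n, h0, hn, hc⟩ := ih
    refine ⟨fun k => if k ≤ n then c k else b', n + 1, by simp [h0], by simp, fun k hk => ?_⟩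
    rcases Nat.lt_succ_iff_lt_or_eq.1 hk with hk | rfl
    · simp only [hk.le, if_true, Nat.succ_le_of_lt hk]
      exact hc k hk
    · simpa [hn] using hbc

/-- If Even were stuck at a reachable position, Odd could replay the path to it and Even would lose
there. -/
theorem moves_nonempty_of_winning (G : ParityGame V d) {f : List V → V} {v₀ : V}
    (hf : ∀ g, G.IsStrategy Player.odd g → G.WonByEven (G.play f g v₀)) {a : List V × V}
    (ha : Relation.ReflTransGen (G.ConsistentStep f) ([], v₀) a)
    (ho : G.owner a.2 = Player.even) : (G.moves a.2).Nonempty := by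
  obtain ⟨c, n, h0, hn, hc⟩ := G.exists_consistent_of_reflTransGen ha
  obtain ⟨g, hg, hst⟩ := G.exists_strategy_of_consistent f c h0
  have hplay : ∀ k ≤ n, G.play f g v₀ k = (c k).2 := fun k hk =>
    congrArg Prod.snd (hst k fun j hj => hc j (by omega))
  by_contra hne
  rcases hf g hg with ⟨m, h1, h2, h3⟩ | ⟨h1, -⟩
  · rcases lt_trichotomy m n with hm | rfl | hm
    · rw [hplay m hm.le] at h2
      exact (Set.eq_empty_iff_forall_notMem.1 h2) _ (hc m hm).1
    · rw [hplay m le_rfl, hn, ho] at h3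
      cases h3
    · have := h1 n hm
      rw [hplay n le_rfl, hn] at this
      exact hne this
  · have := h1 n
    rw [hplay n le_rfl, hn] at this
    exact hne this

/-- Odd plays the finite path to `c 0` and then `c`. From there on priority 2 occurs at most at `c
0`, so with infinitely many 1s the greatest recurring priority would be 1. -/
theorem not_infinite_odd_of_winning (G : ParityGame V 2) {f : List V → V} {v₀ : V}
    (hf : ∀ g, G.IsStrategy Player.odd g → G.WonByEven (G.play f g v₀)) {c : ℕ → List V × V}
    (ha : Relation.ReflTransGen (G.ConsistentStep f) ([], v₀) (c 0))
    (hc : ∀ n, G.ConsistentStep f (c n) (c (n + 1)))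
    (h2 : ∀ n, G.priority (c (n + 1)).2 ≠ 2) : ¬ {n | G.priority (c n).2 = 1}.Infinite := by
  intro hinf
  obtain ⟨c', N, h0, hN, hc'⟩ := G.exists_consistent_of_reflTransGen ha
  obtain ⟨g, hg, hst⟩ := G.exists_strategy_of_consistent f
    (fun k => if k ≤ N then c' k else c (k - N)) (v₀ := v₀) (by simp [h0])
  have hst' : ∀ n, G.state f g v₀ n = if n ≤ N then c' n else c (n - N) := by
    intro n
    refine hst n fun k _ => ?_
    rcases lt_trichotomy k N with hk | rfl | hk
    · simp only [hk.le, if_true, Nat.succ_le_of_lt hk]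
      exact hc' k hk
    · simp only [le_refl, if_true, hN, Nat.succ_le_iff, lt_irrefl, if_false]
      rw [Nat.add_sub_cancel_left]
      exact hc 0
    · simp only [hk.not_ge, if_false, show ¬ k + 1 ≤ N by omega]
      rw [show k + 1 - N = k - N + 1 by omega]
      exact hc _
  have hplay : ∀ n, G.play f g v₀ (N + n) = (c n).2 := by
    intro n
    unfold play
    rw [hst']
    cases n with
    | zero => simp [hN]
    | succ n => simp
  rcases hf g hg with ⟨m, h1, hm, -⟩ | ⟨-, p, ⟨hp, hmax⟩, hev⟩
  · by_cases hmN : m < N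
    · have h3 : G.play f g v₀ m = (c' m).2 := by
        unfold play
        rw [hst', if_pos hmN.le]
      rw [h3] at hm
      exact (Set.eq_empty_iff_forall_notMem.1 hm) _ (hc' m hmN).1
    · have h3 := hplay (m - N)
      rw [Nat.add_sub_cancel' (by omega)] at h3
      rw [h3] at hm
      exact (Set.eq_empty_iff_forall_notMem.1 hm) _ (hc (m - N)).1
  · have hp1 : (1 : Fin 3) ≤ p := by
      apply hmax
      refine (hinf.image (f := fun n => N + n) (fun a _ b _ h => by simpa using h)).mono ?_
      rintro _ ⟨n, hn, rfl⟩
      show G.priority (G.play f g v₀ (N + n)) = 1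
      rw [hplay]
      exact hn
    have hp2 : p = 2 := by
      fin_cases p
      · exact absurd hp1 (by decide)
      · exact absurd hev (by decide)
      · rfl
    subst hp2
    obtain ⟨n, hn, hlt⟩ := hp.exists_gt N
    have h3 := hplay (n - N)
    rw [Nat.add_sub_cancel' hlt.le] at h3
    rw [Set.mem_ofPred_eq, h3] at hn
    obtain ⟨k, hk⟩ : ∃ k, n - N = k + 1 := ⟨n - N - 1, by omega⟩
    rw [hk] at hn
    exact h2 k hn

end ParityGame

/-! ### Answers of least rank -/

namespace NBTA

variable {S : Type u} {ar : S → ℕ} {X : Type v} {Y : Type w}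

/-- The least rank of a pair in `T`. -/
noncomputable def leastRank (T : Set ((X × Y) × ℕ)) (q : X × Y) : ℕ := sInf {n | (q, n) ∈ T}

/-- `p` is an admissible successor of `q`. -/
def RankStep (A : NBTA ar X) (B : NBTA ar Y) (T : Set ((X × Y) × ℕ)) (q p : X × Y) : Prop :=
  (∃ n, (p, n) ∈ T) ∧ (q.2 ∈ B.acc ∨
    (leastRank T p ≤ leastRank T q ∧ (q.1 ∈ A.acc → leastRank T p < leastRank T q)))

/-- A pair may carry several ranks. Answering from the least one, and measuring successors by their
least rank too, makes the rank a function of the pair, so no rank need be remembered during a play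
or along a run. -/
theorem IsRankedSimulation.mem_simStep {A : NBTA ar X} {B : NBTA ar Y} {T : Set ((X × Y) × ℕ)}
    (hT : IsRankedSimulation A B T) {q : X × Y} (hq : ∃ n, (q, n) ∈ T) :
    q ∈ simStep A B {p | RankStep A B T q p} := by
  have hmin : (q, leastRank T q) ∈ T := Nat.sInf_mem (s := {n | (q, n) ∈ T}) hq
  refine simStep_mono A B ?_ (hT.step q _ hmin)
  rintro p ⟨k, hk, h⟩
  have hle : leastRank T p ≤ k := Nat.sInf_le (s := {n | (p, n) ∈ T}) hk
  refine ⟨⟨k, hk⟩, h.imp_right fun h => ⟨hle.trans h.1, fun hx => hle.trans_lt (h.2 hx)⟩⟩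

theorem infinite_acc_of_rankStep {A : NBTA ar X} {B : NBTA ar Y} {T : Set ((X × Y) × ℕ)}
    {q : ℕ → X × Y} (hq : ∀ k, RankStep A B T (q k) (q (k + 1)))
    (hX : {k | (q k).1 ∈ A.acc}.Infinite) : {k | (q k).2 ∈ B.acc}.Infinite :=
  Set.Infinite.of_rank (fun k => leastRank T (q k)) (fun k => (hq k).2) hX

/-! ### Playing along a ranked simulation -/

/-- The moves of Even that follow the ranked simulation `T`. -/
inductive GoodMove (A : NBTA ar X) (B : NBTA ar Y) (T : Set ((X × Y) × ℕ)) :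
    List (SimPosition ar X Y) → SimPosition ar X Y → Prop
  | init (h : List (SimPosition ar X Y)) (x : X) (y : Y) (hy : y ∈ B.init)
      (hxy : ∃ n, ((x, y), n) ∈ T) :
      GoodMove A B T (h ++ [SimPosition.state x]) (SimPosition.pair (x, y))
  | answer (h : List (SimPosition ar X Y)) (q : X × Y) (a : Branching ar X)
      (ys : Fin (ar a.1) → Y) (hys : (⟨a.1, ys⟩ : Branching ar Y) ∈ B.δ q.2)
      (hq : ∀ i, RankStep A B T q (a.2 i, ys i)) :
      GoodMove A B T (h ++ [SimPosition.pair q] ++ [SimPosition.trans a q.2])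
        (SimPosition.tuple (List.ofFn fun i => (a.2 i, ys i)))

theorem GoodMove.legal {A : NBTA ar X} {B : NBTA ar Y} {T : Set ((X × Y) × ℕ)}
    {l : List (SimPosition ar X Y)} {w : SimPosition ar X Y} (hw : GoodMove A B T l w)
    {h : List (SimPosition ar X Y)} {v : SimPosition ar X Y} (hl : l = h ++ [v]) :
    w ∈ (simGame A B).moves v := by
  cases hw with
  | init h' x y hy hxy =>
    simp at hl
    rw [← hl.2]
    exact ⟨y, hy, rfl⟩
  | answer h' q a ys hys hq =>
    obtain ⟨-, he⟩ := List.append_inj' hl rfl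
    simp at he
    rw [← he]
    exact ⟨ys, hys, rfl⟩

theorem GoodMove.init_inv {A : NBTA ar X} {B : NBTA ar Y} {T : Set ((X × Y) × ℕ)}
    {h : List (SimPosition ar X Y)} {x : X} {w : SimPosition ar X Y}
    (hw : GoodMove A B T (h ++ [SimPosition.state x]) w) :
    ∃ y ∈ B.init, (∃ n, ((x, y), n) ∈ T) ∧ w = SimPosition.pair (x, y) := by
  generalize hl : h ++ [SimPosition.state x] = l at hw
  cases hw with
  | init h' x' y hy hxy =>
    simp at hl
    obtain ⟨-, rfl⟩ := hl
    exact ⟨y, hy, hxy, rfl⟩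
  | answer h' q a ys hys hq =>
    obtain ⟨-, he⟩ := List.append_inj' hl rfl
    simp at he

/-- The position `trans a q.2` has forgotten the state of `A`, so Even reads `q` off the position
before it in the history; this determines `q`. -/
theorem GoodMove.answer_inv {A : NBTA ar X} {B : NBTA ar Y} {T : Set ((X × Y) × ℕ)}
    {h : List (SimPosition ar X Y)} {q : X × Y} {a : Branching ar X} {w : SimPosition ar X Y}
    (hw : GoodMove A B T (h ++ [SimPosition.pair q] ++ [SimPosition.trans a q.2]) w) :
    ∃ l, (∀ p ∈ l, RankStep A B T q p) ∧ w = SimPosition.tuple l := by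
  generalize hl : h ++ [SimPosition.pair q] ++ [SimPosition.trans a q.2] = l at hw
  cases hw with
  | init h' x' y hy hxy =>
    obtain ⟨-, he⟩ := List.append_inj' hl rfl
    simp at he
  | answer h' q' a' ys hys hq =>
    obtain ⟨he, -⟩ := List.append_inj' hl rfl
    obtain ⟨-, he⟩ := List.append_inj' he rfl
    simp at he
    subst he
    refine ⟨_, ?_, rfl⟩
    intro p hp
    obtain ⟨i, rfl⟩ := List.mem_ofFn.1 hp
    exact hq i

section Play

variable {A : NBTA ar X} {B : NBTA ar Y} {T : Set ((X × Y) × ℕ)}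
  {f g : List (SimPosition ar X Y) → SimPosition ar X Y}

theorem play_two (hT : IsRankedSimulation A B T) (hf : ∀ l w, GoodMove A B T l w →
    GoodMove A B T l (f l)) (hg : (simGame A B).IsStrategy Player.odd g)
    (h0 : ((simGame A B).moves SimPosition.start).Nonempty) :
    (∃ x ∈ A.init, (simGame A B).play f g SimPosition.start 1 = SimPosition.state x) ∧
    ((simGame A B).moves ((simGame A B).play f g SimPosition.start 1)).Nonempty ∧
    ∃ q, (∃ n, (q, n) ∈ T) ∧
      (simGame A B).play f g SimPosition.start 2 = SimPosition.pair q := by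
  obtain ⟨x, hx, h1⟩ := hg [] SimPosition.start rfl h0
  have hs1 : (simGame A B).state f g SimPosition.start 1 =
      ([SimPosition.start], SimPosition.state x) := by
    rw [ParityGame.state_succ]
    exact Prod.ext rfl h1
  obtain ⟨y, hy, n, hn⟩ := hT.covers x hx
  obtain ⟨y', hy', hn', hw⟩ := (hf _ _ (GoodMove.init [SimPosition.start] x y hy ⟨n, hn⟩)).init_inv
  refine ⟨⟨x, hx, congrArg Prod.snd hs1⟩, ?_, (x, y'), hn', ?_⟩
  · unfold ParityGame.play
    rw [hs1]
    exact ⟨_, y', hy', rfl⟩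
  · unfold ParityGame.play
    rw [ParityGame.state_succ, hs1]
    exact hw

theorem play_round (hT : IsRankedSimulation A B T) (hf : ∀ l w, GoodMove A B T l w →
    GoodMove A B T l (f l)) (hg : (simGame A B).IsStrategy Player.odd g) {n : ℕ} {q : X × Y}
    (hq : ∃ k, (q, k) ∈ T)
    (hn : (simGame A B).play f g SimPosition.start n = SimPosition.pair q)
    (h0 : ((simGame A B).moves ((simGame A B).play f g SimPosition.start n)).Nonempty) :
    (∃ a y, (simGame A B).play f g SimPosition.start (n + 1) = SimPosition.trans a y) ∧
    ((simGame A B).moves ((simGame A B).play f g SimPosition.start (n + 1))).Nonempty ∧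
    (∃ l, (simGame A B).play f g SimPosition.start (n + 2) = SimPosition.tuple l) ∧
    (((simGame A B).moves ((simGame A B).play f g SimPosition.start (n + 2))).Nonempty →
      ∃ p, RankStep A B T q p ∧
        (simGame A B).play f g SimPosition.start (n + 3) = SimPosition.pair p) := by
  obtain ⟨h, hs⟩ : ∃ h, (simGame A B).state f g SimPosition.start n = (h, SimPosition.pair q) :=
    ⟨_, Prod.ext rfl hn⟩
  rw [hn] at h0
  obtain ⟨a, ha, h1⟩ := hg h (SimPosition.pair q) rfl h0
  have hs1 : (simGame A B).state f g SimPosition.start (n + 1) =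
      (h ++ [SimPosition.pair q], SimPosition.trans a q.2) := by
    rw [ParityGame.state_succ, hs]
    exact Prod.ext rfl h1
  obtain ⟨ys, hys, hst⟩ := hT.mem_simStep hq a ha
  obtain ⟨l, hl, hw⟩ := (hf _ _ (GoodMove.answer h q a ys hys hst)).answer_inv
  have hs2 : (simGame A B).state f g SimPosition.start (n + 2) =
      (h ++ [SimPosition.pair q] ++ [SimPosition.trans a q.2], SimPosition.tuple l) := by
    rw [ParityGame.state_succ, hs1]
    exact Prod.ext rfl hw
  refine ⟨⟨a, q.2, congrArg Prod.snd hs1⟩, ?_, ⟨l, congrArg Prod.snd hs2⟩, fun h2 => ?_⟩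
  · unfold ParityGame.play
    rw [hs1]
    exact ⟨_, ys, hys, rfl⟩
  · unfold ParityGame.play at h2 ⊢
    rw [hs2] at h2
    obtain ⟨p, hp, h3⟩ := hg (h ++ [SimPosition.pair q] ++ [SimPosition.trans a q.2])
      (SimPosition.tuple l) rfl h2
    refine ⟨p, hl p hp, ?_⟩
    rw [ParityGame.state_succ, hs2]
    exact h3

/-- Only pairs have nonzero priority. If accepting `B`-states recur, 2 is the greatest recurring
priority; if not, the rank argument excludes recurring accepting `A`-states, and only 0 recurs. -/
theorem wonByEven_of_pairs {r : ℕ → SimPosition ar X Y} {q : ℕ → X × Y}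
    (hne : ∀ n, ((simGame A B).moves (r n)).Nonempty)
    (hpair : ∀ k, r (2 + 3 * k) = SimPosition.pair (q k))
    (hother : ∀ n, (∃ k, n = 2 + 3 * k) ∨ (simGame A B).priority (r n) = 0)
    (hq : ∀ k, RankStep A B T (q k) (q (k + 1))) : (simGame A B).WonByEven r := by
  refine Or.inr ⟨hne, ?_⟩
  have hprio : ∀ k, (q k).2 ∈ B.acc → (simGame A B).priority (r (2 + 3 * k)) = 2 := by
    intro k hk
    rw [hpair]
    exact if_pos hk
  have hprio1 : ∀ k, (simGame A B).priority (r (2 + 3 * k)) = 2 → (q k).2 ∈ B.acc := by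
    intro k hk
    by_contra hy
    rw [hpair] at hk
    simp only [simGame, if_neg hy] at hk
    split_ifs at hk <;> cases hk
  have hprio2 : ∀ k, (simGame A B).priority (r (2 + 3 * k)) = 1 → (q k).1 ∈ A.acc := by
    intro k hk
    by_contra hy
    rw [hpair] at hk
    simp only [simGame, if_neg hy] at hk
    split_ifs at hk <;> cases hk
  have hinj : Set.InjOn (fun k : ℕ => 2 + 3 * k) Set.univ := by
    intro a _ b _ h
    have : 2 + 3 * a = 2 + 3 * b := h
    omega
  by_cases hacc : {k | (q k).2 ∈ B.acc}.Infinite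
  · refine ⟨2, ⟨?_, fun p _ => Fin.le_last p⟩, by decide⟩
    refine (hacc.image (hinj.mono (Set.subset_univ _))).mono ?_
    rintro _ ⟨k, hk, rfl⟩
    exact hprio k hk
  · have haccX : ¬ {k | (q k).1 ∈ A.acc}.Infinite := fun h =>
      hacc (infinite_acc_of_rankStep hq h)
    have h2 : ¬ {n | (simGame A B).priority (r n) = 2}.Infinite := by
      rw [Set.not_infinite] at hacc ⊢
      refine (hacc.image (fun k : ℕ => 2 + 3 * k)).subset ?_
      intro n hn
      rcases hother n with ⟨k, rfl⟩ | h
      · exact ⟨k, hprio1 k hn, rfl⟩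
      · exact absurd (hn.symm.trans h) (by decide)
    have h1 : ¬ {n | (simGame A B).priority (r n) = 1}.Infinite := by
      rw [Set.not_infinite] at haccX ⊢
      refine (haccX.image (fun k : ℕ => 2 + 3 * k)).subset ?_
      intro n hn
      rcases hother n with ⟨k, rfl⟩ | h
      · exact ⟨k, hprio2 k hn, rfl⟩
      · exact absurd (hn.symm.trans h) (by decide)
    refine ⟨0, ⟨?_, ?_⟩, by decide⟩
    -- Pairs sit at indices congruent to 2 modulo 3, so the multiples of 3 provide infinitely many
    -- positions of priority 0.
    · have hinj' : Set.InjOn (fun k : ℕ => 3 * k) Set.univ := by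
        intro a _ b _ h
        have : 3 * a = 3 * b := h
        omega
      refine ((Set.infinite_univ (α := ℕ)).image hinj').mono ?_
      rintro _ ⟨k, -, rfl⟩
      rcases hother (3 * k) with ⟨j, hj⟩ | h
      · omega
      · exact h
    · intro p hp
      fin_cases p
      · exact le_rfl
      · exact absurd hp h1
      · exact absurd hp h2

end Play

theorem IsRankedSimulation.evenWins {A : NBTA ar X} {B : NBTA ar Y} {T : Set ((X × Y) × ℕ)}
    (hT : IsRankedSimulation A B T) : (simGame A B).EvenWins SimPosition.start := by
  have : Nonempty (SimPosition ar X Y) := ⟨SimPosition.start⟩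
  obtain ⟨f, hfs, hf⟩ := (simGame A B).exists_legal_function (GoodMove A B T)
    (fun h v w hw => hw.legal rfl)
  refine ⟨f, hfs _, fun g hg => ?_⟩
  set r := (simGame A B).play f g SimPosition.start with hr
  have hr0 : r 0 = SimPosition.start := rfl
  have hpos : ∀ k, (∀ j < 2 + 3 * k, ((simGame A B).moves (r j)).Nonempty) →
      ∃ q, (∃ n, (q, n) ∈ T) ∧ r (2 + 3 * k) = SimPosition.pair q := by
    intro k
    induction k with
    | zero => exact fun h => (play_two hT hf hg (h 0 (by omega))).2.2
    | succ k ih =>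
      intro h
      obtain ⟨q, hq, hk⟩ := ih fun j hj => h j (by omega)
      obtain ⟨-, -, -, h3⟩ := play_round hT hf hg hq hk (h _ (by omega))
      obtain ⟨p, hp, hrp⟩ := h3 (h _ (by omega))
      exact ⟨p, hp.1, hrp⟩
  by_cases hne : ∀ n, ((simGame A B).moves (r n)).Nonempty
  · choose q hqT hq using fun k => hpos k fun j _ => hne j
    refine wonByEven_of_pairs (T := T) hne hq ?_ ?_
    · intro n
      rcases n with _ | _ | n
      · exact Or.inr rfl
      · obtain ⟨x, -, hx⟩ := (play_two hT hf hg (hne 0)).1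
        refine Or.inr ?_
        show (simGame A B).priority (r 1) = 0
        rw [hr, hx]
        rfl
      -- After the two opening moves each round takes three, so index `n + 2` falls in round `n /
      -- 3`.
      · have hround := play_round hT hf hg (hqT (n / 3)) (hq (n / 3)) (hne _)
        obtain h | h | h : n + 2 = 2 + 3 * (n / 3) ∨ n + 2 = 2 + 3 * (n / 3) + 1 ∨
            n + 2 = 2 + 3 * (n / 3) + 2 := by omega
        · exact Or.inl ⟨_, h⟩
        · obtain ⟨a, y, hay⟩ := hround.1
          refine Or.inr ?_
          show (simGame A B).priority (r (n + 2)) = 0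
          rw [h, hr, hay]
          rfl
        · obtain ⟨l, hl⟩ := hround.2.2.1
          refine Or.inr ?_
          show (simGame A B).priority (r (n + 2)) = 0
          rw [h, hr, hl]
          rfl
    · intro k
      obtain ⟨-, -, -, h3⟩ := play_round hT hf hg (hqT k) (hq k) (hne _)
      obtain ⟨p, hp, hrp⟩ := h3 (hne _)
      have := (hq (k + 1)).symm.trans hrp
      cases this
      exact hp
  -- A finite play stops at its first dead end. Even's positions always offer an answer, so the dead
  -- end belongs to Odd.
  · push Not at hne
    classical
    have hmin : ∀ j < Nat.find hne, ((simGame A B).moves (r j)).Nonempty := fun j hj =>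
      Set.nonempty_iff_ne_empty.2 (Nat.find_min hne hj)
    have hend := Nat.find_spec hne
    generalize Nat.find hne = n at hmin hend
    refine Or.inl ⟨n, hmin, hend, ?_⟩
    rcases n with _ | _ | n
    · rfl
    · have := (play_two hT hf hg (hmin 0 (by omega))).2.1
      exact absurd hend this.ne_empty
    · obtain ⟨q, hq, hk⟩ := hpos (n / 3) fun j hj => hmin j (by omega)
      obtain h | h | h : n + 2 = 2 + 3 * (n / 3) ∨ n + 2 = 2 + 3 * (n / 3) + 1 ∨
          n + 2 = 2 + 3 * (n / 3) + 2 := by omega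
      · show (simGame A B).owner (r (n + 2)) = Player.odd
        rw [h, hk]
        rfl
      · have := (play_round hT hf hg hq hk (hmin _ (by omega))).2.1
        rw [← h] at this
        exact absurd hend this.ne_empty
      · obtain ⟨l, hl⟩ := (play_round hT hf hg hq hk (hmin _ (by omega))).2.2.1
        show (simGame A B).owner (r (n + 2)) = Player.odd
        rw [h, hr, hl]
        rfl

/-! ### From winning strategies to fair simulations -/

/-- One round of the game, from a pair to a pair, against the strategy `f` of Even. -/
theorem mem_simStep_of_winning {A : NBTA ar X} {B : NBTA ar Y}
    {f : List (SimPosition ar X Y) → SimPosition ar X Y}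
    (hfs : (simGame A B).IsStrategy Player.even f)
    (hf : ∀ g, (simGame A B).IsStrategy Player.odd g →
      (simGame A B).WonByEven ((simGame A B).play f g SimPosition.start))
    {h : List (SimPosition ar X Y)} {q : X × Y}
    (hr : Relation.ReflTransGen ((simGame A B).ConsistentStep f) ([], SimPosition.start)
      (h, SimPosition.pair q)) :
    q ∈ simStep A B {p | ∃ h', Relation.ReflTransGen ((simGame A B).ConsistentStep f)
        ([], SimPosition.start) (h', SimPosition.pair p) ∧
      ((simGame A B).priority (SimPosition.pair p) ≠ 2 → Relation.TransGen
        (fun a b => (simGame A B).ConsistentStep f a b ∧ (simGame A B).priority b.2 ≠ 2)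
        (h, SimPosition.pair q) (h', SimPosition.pair p))} := by
  intro a ha
  have s1 : (simGame A B).ConsistentStep f (h, SimPosition.pair q)
      (h ++ [SimPosition.pair q], SimPosition.trans a q.2) :=
    ⟨⟨a, ha, rfl⟩, (fun h => by cases h), rfl⟩
  have hne := (simGame A B).moves_nonempty_of_winning hf (hr.tail s1) rfl
  obtain ⟨ys, hys, hw⟩ := hfs (h ++ [SimPosition.pair q]) (SimPosition.trans a q.2) rfl hne
  refine ⟨ys, hys, fun i => ?_⟩
  have s2 : (simGame A B).ConsistentStep f (h ++ [SimPosition.pair q], SimPosition.trans a q.2)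
      (h ++ [SimPosition.pair q] ++ [SimPosition.trans a q.2],
        SimPosition.tuple (List.ofFn fun i => (a.2 i, ys i))) :=
    ⟨⟨ys, hys, rfl⟩, fun _ => hw.symm, rfl⟩
  have s3 : (simGame A B).ConsistentStep f (h ++ [SimPosition.pair q] ++
        [SimPosition.trans a q.2], SimPosition.tuple (List.ofFn fun i => (a.2 i, ys i)))
      (h ++ [SimPosition.pair q] ++ [SimPosition.trans a q.2] ++
        [SimPosition.tuple (List.ofFn fun i => (a.2 i, ys i))],
        SimPosition.pair (a.2 i, ys i)) :=
    ⟨⟨_, List.mem_ofFn.2 ⟨i, rfl⟩, rfl⟩, (fun h => by cases h), rfl⟩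
  refine ⟨_, ((hr.tail s1).tail s2).tail s3, fun hp => ?_⟩
  have h02 : (0 : Fin 3) ≠ 2 := by decide
  exact ((Relation.TransGen.single ⟨s1, h02⟩).tail ⟨s2, h02⟩).tail ⟨s3, hp⟩

open Classical in
theorem exists_isFairSimulation_of_evenWins {A : NBTA ar X} {B : NBTA ar Y}
    (hE : (simGame A B).EvenWins SimPosition.start) : ∃ R, IsFairSimulation A B R := by
  obtain ⟨f, hfs, hf⟩ := hE
  set G := simGame A B with hG
  set W : Set (X × Y) := {q | ∃ h, Relation.ReflTransGen (G.ConsistentStep f)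
    ([], SimPosition.start) (h, SimPosition.pair q)} with hW
  refine ⟨W, ?_, subset_simUnion_solution A B W ?_ ?_⟩
  · intro x hx
    have s1 : G.ConsistentStep f ([], SimPosition.start)
        ([SimPosition.start], SimPosition.state x) :=
      ⟨⟨x, hx, rfl⟩, (fun h => by cases h), rfl⟩
    have hne := G.moves_nonempty_of_winning hf (Relation.ReflTransGen.single s1) rfl
    obtain ⟨y, hy, hw⟩ := hfs [SimPosition.start] (SimPosition.state x) rfl hne
    have s2 : G.ConsistentStep f ([SimPosition.start], SimPosition.state x)
        ([SimPosition.start] ++ [SimPosition.state x], SimPosition.pair (x, y)) :=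
      ⟨⟨y, hy, rfl⟩, fun _ => hw.symm, rfl⟩
    exact ⟨y, hy, _, (Relation.ReflTransGen.single s1).tail s2⟩
  · rintro q ⟨h, hr⟩
    refine simStep_mono A B ?_ (mem_simStep_of_winning hfs hf hr)
    rintro p ⟨h', hp, -⟩
    exact ⟨h', hp⟩
  · intro U hU2 hU1 hU0 q₁ hq₁
    by_contra hq₁U
    set r : List (SimPosition ar X Y) × SimPosition ar X Y → _ → Prop :=
      fun a b => G.ConsistentStep f a b ∧ G.priority b.2 ≠ 2 with hrdef
    have hr_mono : ∀ a b, Relation.TransGen r a b → Relation.ReflTransGen (G.ConsistentStep f) a b :=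
      fun a b hab => (Relation.TransGen.mono (p := G.ConsistentStep f) (fun _ _ h => h.1) _ _ hab).to_reflTransGen
    -- Odd can reach an accepting state of `A` outside `U`.
    have key : ∀ h q, Relation.ReflTransGen (G.ConsistentStep f) ([], SimPosition.start)
        (h, SimPosition.pair q) → q ∉ U → ∃ h' p,
        Relation.TransGen r (h, SimPosition.pair q) (h', SimPosition.pair p) ∧
        p ∉ U ∧ p.1 ∈ A.acc ∧ p.2 ∉ B.acc := by
      intro h q hr hqU
      by_contra! hesc
      -- The doubly non-accepting pairs reachable from here without meeting priority 2. If Odd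
      -- cannot escape as claimed, every answer from them stays in `U ∪ V`.
      set V : Set (X × Y) := {p | (p.1 ∉ A.acc ∧ p.2 ∉ B.acc) ∧
        ∃ h', Relation.ReflTransGen r (h, SimPosition.pair q) (h', SimPosition.pair p)} with hV
      have hstep : ∀ h' p, Relation.ReflTransGen r (h, SimPosition.pair q)
          (h', SimPosition.pair p) → p ∈ simStep A B (U ∪ V) := by
        intro h' p hp
        have hp' := hr.trans (Relation.ReflTransGen.mono (p := G.ConsistentStep f) (fun _ _ h => h.1) _ _ hp)
        refine simStep_mono A B ?_ (mem_simStep_of_winning hfs hf hp')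
        rintro p' ⟨h'', hp'', ht⟩
        by_cases hy : p'.2 ∈ B.acc
        · exact Or.inl (hU2 p' ⟨h'', hp''⟩ hy)
        have ht := ht (by
          show (if p'.2 ∈ B.acc then (2 : Fin 3) else if p'.1 ∈ A.acc then 1 else 0) ≠ 2
          rw [if_neg hy]
          split_ifs <;> decide)
        have ht' : Relation.TransGen r (h, SimPosition.pair q) (h'', SimPosition.pair p') :=
          Relation.TransGen.trans_right hp ht
        by_cases hx : p'.1 ∈ A.acc
        · by_cases hp'U : p' ∈ U
          · exact Or.inl hp'U
          · exact absurd (hesc h'' p' ht' hp'U hx) hy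
        · exact Or.inr ⟨⟨hx, hy⟩, h'', ht'.to_reflTransGen⟩
      -- The greatest fixed point property absorbs `V` into `U`; then each of the three possible
      -- types of `q` forces `q ∈ U`.
      have hVU : V ⊆ U := hU0 V (fun p hp => hp.1) fun p hp => hstep _ _ hp.2.choose_spec
      by_cases hy : q.2 ∈ B.acc
      · exact hqU (hU2 q ⟨h, hr⟩ hy)
      by_cases hx : q.1 ∈ A.acc
      · refine hqU (hU1 q ?_ hx hy)
        have := hstep h q Relation.ReflTransGen.refl
        rwa [Set.union_eq_self_of_subset_right hVU] at this
      · exact hqU (hVU ⟨⟨hx, hy⟩, h, Relation.ReflTransGen.refl⟩)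
    -- Iterating the escape yields one infinite play consistent with `f` that meets priority 1
    -- infinitely often and never enters priority 2.
    obtain ⟨h₁, hr₁⟩ := hq₁
    obtain ⟨h₂, q₂, ht₂, hq₂, hx₂, hy₂⟩ := key h₁ q₁ hr₁ hq₁U
    obtain ⟨c, hc0, hc, hinf⟩ := exists_chain_of_transGen (r := r)
      (Q := fun s => Relation.ReflTransGen (G.ConsistentStep f) ([], SimPosition.start) s ∧
        ∃ p : X × Y, s.2 = SimPosition.pair p ∧ p ∉ U ∧ p.1 ∈ A.acc ∧ p.2 ∉ B.acc)
      (by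
        rintro ⟨h, v⟩ ⟨hr, p, rfl, hp, -, -⟩
        obtain ⟨h', p', ht, hp'⟩ := key h p hr hp
        exact ⟨_, ⟨hr.trans (hr_mono _ _ ht), p', rfl, hp'⟩, ht⟩)
      (s₀ := (h₂, SimPosition.pair q₂)) ⟨hr₁.trans (hr_mono _ _ ht₂), q₂, rfl, hq₂, hx₂, hy₂⟩
    refine G.not_infinite_odd_of_winning hf (c := c) ?_ (fun n => (hc n).1) (fun n => (hc n).2) ?_
    · rw [hc0]
      exact hr₁.trans (hr_mono _ _ ht₂)
    · refine hinf.mono ?_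
      rintro n ⟨-, p, hp, -, hx, hy⟩
      show G.priority (c n).2 = 1
      rw [hp]
      show (if p.2 ∈ B.acc then (2 : Fin 3) else if p.1 ∈ A.acc then 1 else 0) = 1
      rw [if_neg hy, if_pos hx]

/-! ### Language inclusion -/

/-- The run of `B` is built from the root downwards, each node answering the transition of `ρ`
there. Along a branch the pairs of states form a chain of ranked steps, so acceptance carries over.
-/
theorem IsRankedSimulation.language_subset {A : NBTA ar X} {B : NBTA ar Y}
    {T : Set ((X × Y) × ℕ)} (hT : IsRankedSimulation A B T) : A.language ⊆ B.language := by
  classical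
  rintro t ⟨ρ, hρ, rfl⟩
  obtain ⟨y₀, hy₀, hn₀⟩ := hT.covers _ ρ.root_init
  have hans : ∀ (q : X × Y) (a : Branching ar X), ∃ ys : Fin (ar a.1) → Y,
      (∃ n, (q, n) ∈ T) → a ∈ A.δ q.1 →
      (⟨a.1, ys⟩ : Branching ar Y) ∈ B.δ q.2 ∧ ∀ i, RankStep A B T q (a.2 i, ys i) := by
    intro q a
    by_cases h : (∃ n, (q, n) ∈ T) ∧ a ∈ A.δ q.1
    · obtain ⟨ys, h1, h2⟩ := hT.mem_simStep h.1 a h.2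
      exact ⟨ys, fun _ _ => ⟨h1, h2⟩⟩
    · exact ⟨fun _ => y₀, fun h1 h2 => absurd ⟨h1, h2⟩ h⟩
  choose ans hans using hans
  let tr : ρ.dom → Branching ar X := fun p =>
    ⟨(ρ.label p).1, fun i => (ρ.label (ρ.toRankedTree.child p i)).2⟩
  -- Positions list the root first, whereas list recursion peels the head, so the recursion runs on
  -- reversed words. `y₀` is the true value at the root and a dummy outside the tree.
  let st : List ℕ → Y := fun p => List.rec y₀ (fun i p y =>
    if h : ∃ (hp : p.reverse ∈ ρ.dom), i < ar (tr ⟨p.reverse, hp⟩).1 then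
      ans ((ρ.label ⟨p.reverse, h.1⟩).2, y) (tr ⟨p.reverse, h.1⟩) ⟨i, h.2⟩ else y₀) p
  let stp : ρ.dom → Y := fun p => st p.1.reverse
  have hst : ∀ (p : ρ.dom) (i : Fin (ar (tr p).1)), stp (ρ.toRankedTree.child p i) =
      ans ((ρ.label p).2, stp p) (tr p) i := by
    rintro ⟨p, hp⟩ i
    have hgen : ∀ l : List ℕ, ∀ hl : l.reverse ∈ ρ.dom, ∀ i : Fin (ar (tr ⟨l.reverse, hl⟩).1),
        st (i.1 :: l) = ans ((ρ.label ⟨l.reverse, hl⟩).2, st l) (tr ⟨l.reverse, hl⟩) i :=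
      fun l hl i => dif_pos ⟨hl, i.2⟩
    have hrev : st (p ++ [i.1]).reverse = st (i.1 :: p.reverse) := by simp
    refine hrev.trans ?_
    -- Stated for a variable `l`, so that `p` can be replaced by its double reverse inside the
    -- dependent types.
    have hgen' : ∀ l, l = p → ∀ hl : l ∈ ρ.dom, ∀ i : Fin (ar (tr ⟨l, hl⟩).1),
        st (i.1 :: p.reverse) = ans ((ρ.label ⟨l, hl⟩).2, st p.reverse) (tr ⟨l, hl⟩) i := by
      intro l hl
      obtain rfl : l = p.reverse.reverse := by simpa using hl
      exact hgen p.reverse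
    exact hgen' p rfl hp i
  have hdom : ∀ p : ρ.dom, ∃ n, (((ρ.label p).2, stp p), n) ∈ T := by
    rintro ⟨p, hp⟩
    induction p using List.reverseRecOn with
    | nil => exact hn₀
    | append_singleton p i ih =>
      have hp' := ρ.prefix_closed p i hp
      have hi : i < ar (ρ.label ⟨p, hp'⟩).1 := (ρ.mem_iff_lt_arity ⟨p, hp'⟩ i).1 hp
      have h := ((hans _ _ (ih hp') (ρ.transition ⟨p, hp'⟩)).2 ⟨i, hi⟩).1
      rw [← hst ⟨p, hp'⟩ ⟨i, hi⟩] at h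
      exact h
  have hstep : ∀ (p : ρ.dom) (i : Fin (ar (tr p).1)),
      RankStep A B T ((ρ.label p).2, stp p) ((ρ.label (ρ.toRankedTree.child p i)).2,
        stp (ρ.toRankedTree.child p i)) := by
    intro p i
    rw [hst]
    exact (hans _ _ (hdom p) (ρ.transition p)).2 i
  refine ⟨{ dom := ρ.dom, nonempty := ρ.nonempty, prefix_closed := ρ.prefix_closed,
            lower_closed := ρ.lower_closed, label := fun p => ((ρ.label p).1, stp p),
            mem_iff_lt_arity := ρ.mem_iff_lt_arity, transition := ?_, root_init := hy₀ }, ?_, rfl⟩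
  · intro p
    have h := (hans _ _ (hdom p) (ρ.transition p)).1
    have he : ans ((ρ.label p).2, stp p) (tr p) =
        fun i => stp (ρ.toRankedTree.child p i) := funext fun i => (hst p i).symm
    exact he ▸ h
  · intro π hπ
    have hacc := hρ π hπ
    refine infinite_acc_of_rankStep (A := A) (T := T)
      (q := fun n => ((ρ.label ⟨RankedTree.initialSegment π n, hπ n⟩).2,
        stp ⟨RankedTree.initialSegment π n, hπ n⟩)) (fun n => ?_) hacc
    have hs : RankedTree.initialSegment π (n + 1) = RankedTree.initialSegment π n ++ [π n] := by
      simp [RankedTree.initialSegment, List.range_succ]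
    have hmem := hπ (n + 1)
    rw [hs] at hmem
    have h := hstep ⟨_, hπ n⟩ ⟨π n, (ρ.mem_iff_lt_arity ⟨_, hπ n⟩ _).1 hmem⟩
    have he : (⟨RankedTree.initialSegment π (n + 1), hπ (n + 1)⟩ : ρ.dom) =
        ρ.toRankedTree.child ⟨_, hπ n⟩ ⟨π n, (ρ.mem_iff_lt_arity ⟨_, hπ n⟩ _).1 hmem⟩ :=
      Subtype.ext hs
    rw [he]
    exact h

end NBTA

/-! ### Primitive recursive bounded quantifiers -/

section Primrec

variable {α β : Type*} [Primcodable α] [Primcodable β]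

theorem PrimrecPred.exists_mem_comp {f : α → List β} {p : α → β → Prop} (hf : Primrec f)
    (hp : PrimrecPred fun x : α × β => p x.1 x.2) : PrimrecPred fun a => ∃ b ∈ f a, p a b :=
  PrimrecRel.comp (PrimrecRel.exists_mem_list (R := fun b a => p a b)
    (hp.comp (Primrec.pair Primrec.snd Primrec.fst))) hf Primrec.id

theorem PrimrecPred.forall_mem_comp {f : α → List β} {p : α → β → Prop} (hf : Primrec f)
    (hp : PrimrecPred fun x : α × β => p x.1 x.2) : PrimrecPred fun a => ∀ b ∈ f a, p a b :=
  PrimrecRel.comp (PrimrecRel.forall_mem_list (R := fun b a => p a b)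
    (hp.comp (Primrec.pair Primrec.snd Primrec.fst))) hf Primrec.id

theorem PrimrecPred.mem_comp {f : α → List β} {g : α → β} (hf : Primrec f) (hg : Primrec g) :
    PrimrecPred fun a => g a ∈ f a :=
  (PrimrecPred.exists_mem_comp (p := fun a b => b = g a) hf
    (Primrec.eq.comp Primrec.snd (hg.comp Primrec.fst))).of_eq fun a => by simp

theorem PrimrecPred.imp {p q : α → Prop} (hp : PrimrecPred p) (hq : PrimrecPred q) :
    PrimrecPred fun a => p a → q a :=
  (hp.not.or hq).of_eq fun _ => imp_iff_not_or.symm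

end Primrec

/-- Repeatedly shrinking a list leads to a fixed point. -/
theorem List.iterate_sublist_fixed {α : Type*} {F : List α → List α}
    (hF : ∀ l, (F l).Sublist l) (l : List α) {n : ℕ} (hn : l.length ≤ n) :
    F (F^[n] l) = F^[n] l := by
  induction n generalizing l with
  | zero =>
    obtain rfl : l = [] := List.length_eq_zero_iff.1 (by omega)
    exact List.sublist_nil.1 (hF [])
  | succ n ih =>
    by_cases h : F l = l
    · rw [Function.iterate_fixed h, h]
    · rw [Function.iterate_succ_apply]
      refine ih _ ?_
      have := (hF l).length_le
      have : (F l).length ≠ l.length := fun he => h ((hF l).eq_of_length he)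
      omega

/-! ### Deciding fair simulation on finite data -/

namespace NBTA

/-- The list `L` of triples (state, state, rank) allows to answer the transition `tr` from the
triple `t` by the transition `tr'`. -/
def CodeAnswer (c : List ℕ × Code × Code) (L : List (ℕ × ℕ × ℕ)) (t : ℕ × ℕ × ℕ)
    (tr tr' : ℕ × ℕ × List ℕ) : Prop :=
  tr'.1 = t.2.1 ∧ tr'.2.1 = tr.2.1 ∧ tr'.2.2.length = tr.2.2.length ∧
    ∀ i ∈ List.range tr.2.2.length, ∃ u ∈ L,
      u.1 = tr.2.2.getD i 0 ∧ u.2.1 = tr'.2.2.getD i 0 ∧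
        (t.2.1 ∈ c.2.2.2.2.2 ∨ (u.2.2 ≤ t.2.2 ∧ (t.1 ∈ c.2.1.2.2.2 → u.2.2 < t.2.2)))

/-- All transitions of the first automaton from the triple `t` can be answered within `L`. -/
def CodeStep (c : List ℕ × Code × Code) (L : List (ℕ × ℕ × ℕ)) (t : ℕ × ℕ × ℕ) : Prop :=
  ∀ tr ∈ c.2.1.2.1, (tr.1 = t.1 ∧ c.1[tr.2.1]? = some tr.2.2.length ∧
    ∀ e ∈ tr.2.2, e < c.2.1.1) → ∃ tr' ∈ c.2.2.2.1, CodeAnswer c L t tr tr'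

/-- All triples with a bounded rank. -/
def codeTriples (c : List ℕ × Code × Code) : List (ℕ × ℕ × ℕ) :=
  (List.range c.2.1.1).flatMap fun x => (List.range c.2.2.1).flatMap fun y =>
    (List.range (c.2.1.1 * c.2.2.1 + 1)).map fun n => (x, y, n)

open Classical in
/-- Remove the triples that cannot answer within `L`. -/
noncomputable def codeRefine (c : List ℕ × Code × Code) (L : List (ℕ × ℕ × ℕ)) :
    List (ℕ × ℕ × ℕ) :=
  L.filter fun t => decide (CodeStep c L t)

/-- The greatest ranked simulation with bounded ranks. -/
noncomputable def codeSimulation (c : List ℕ × Code × Code) : List (ℕ × ℕ × ℕ) :=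
  (codeRefine c)^[(codeTriples c).length] (codeTriples c)

/-- The initial states of the first automaton are covered by the simulation. -/
def CodeCovers (c : List ℕ × Code × Code) (L : List (ℕ × ℕ × ℕ)) : Prop :=
  ∀ x ∈ c.2.1.2.2.1, x < c.2.1.1 → ∃ y ∈ c.2.2.2.2.1, ∃ u ∈ L, u.1 = x ∧ u.2.1 = y

/-! ### Computability -/

section Computability

open Primrec

theorem primrecPred_codeStep : PrimrecPred fun e : ((List ℕ × Code × Code) ×
    List (ℕ × ℕ × ℕ)) × (ℕ × ℕ × ℕ) => CodeStep e.1.1 e.1.2 e.2 := by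
  unfold CodeStep CodeAnswer
  refine PrimrecPred.forall_mem_comp
    (fst.comp (snd.comp (fst.comp (snd.comp (fst.comp fst))))) ?_
  refine PrimrecPred.imp ?_ ?_
  · refine PrimrecPred.and (Primrec.eq.comp (fst.comp snd) (fst.comp (snd.comp fst)))
      (PrimrecPred.and (Primrec.eq.comp ?_ ?_) ?_)
    · exact list_getElem?.comp (fst.comp (fst.comp (fst.comp fst))) (fst.comp (snd.comp snd))
    · exact option_some.comp (list_length.comp (snd.comp (snd.comp snd)))
    · refine PrimrecPred.forall_mem_comp (snd.comp (snd.comp snd)) (nat_lt.comp snd ?_)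
      exact fst.comp (fst.comp (snd.comp (fst.comp (fst.comp (fst.comp fst)))))
  · refine PrimrecPred.exists_mem_comp
      (fst.comp (snd.comp (snd.comp (snd.comp (fst.comp (fst.comp fst)))))) ?_
    refine PrimrecPred.and (Primrec.eq.comp (fst.comp snd)
      (fst.comp (snd.comp (snd.comp (fst.comp fst))))) (PrimrecPred.and ?_ (PrimrecPred.and ?_ ?_))
    · exact Primrec.eq.comp (fst.comp (snd.comp snd)) (fst.comp (snd.comp (snd.comp fst)))
    · exact Primrec.eq.comp (list_length.comp (snd.comp (snd.comp snd)))
        (list_length.comp (snd.comp (snd.comp (snd.comp fst))))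
    · refine PrimrecPred.forall_mem_comp
        (list_range.comp (list_length.comp (snd.comp (snd.comp (snd.comp fst))))) ?_
      refine PrimrecPred.exists_mem_comp (snd.comp (fst.comp (fst.comp (fst.comp fst)))) ?_
      have ht : Primrec fun e : ((((((List ℕ × Code × Code) × List (ℕ × ℕ × ℕ)) × (ℕ × ℕ × ℕ)) ×
          (ℕ × ℕ × List ℕ)) × (ℕ × ℕ × List ℕ)) × ℕ) × (ℕ × ℕ × ℕ) => e.1.1.1.1.2 :=
        snd.comp (fst.comp (fst.comp (fst.comp fst)))
      have hc : Primrec fun e : ((((((List ℕ × Code × Code) × List (ℕ × ℕ × ℕ)) × (ℕ × ℕ × ℕ)) ×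
          (ℕ × ℕ × List ℕ)) × (ℕ × ℕ × List ℕ)) × ℕ) × (ℕ × ℕ × ℕ) => e.1.1.1.1.1.1 :=
        fst.comp (fst.comp (fst.comp (fst.comp (fst.comp fst))))
      refine PrimrecPred.and (Primrec.eq.comp (fst.comp snd) ?_) (PrimrecPred.and
        (Primrec.eq.comp (fst.comp (snd.comp snd)) ?_) (PrimrecPred.or ?_ (PrimrecPred.and ?_
          (PrimrecPred.imp ?_ ?_))))
      · exact (list_getD 0).comp (snd.comp (snd.comp (snd.comp (fst.comp (fst.comp fst)))))
          (snd.comp fst)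
      · exact (list_getD 0).comp (snd.comp (snd.comp (snd.comp (fst.comp fst)))) (snd.comp fst)
      · exact PrimrecPred.mem_comp (snd.comp (snd.comp (snd.comp (snd.comp (snd.comp hc)))))
          (fst.comp (snd.comp ht))
      · exact nat_le.comp (snd.comp (snd.comp snd)) (snd.comp (snd.comp ht))
      · exact PrimrecPred.mem_comp (snd.comp (snd.comp (snd.comp (fst.comp (snd.comp hc)))))
          (fst.comp ht)
      · exact nat_lt.comp (snd.comp (snd.comp snd)) (snd.comp (snd.comp ht))

theorem primrec_codeTriples : Primrec codeTriples := by
  unfold codeTriples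
  refine list_flatMap (list_range.comp (fst.comp (fst.comp snd))) ?_
  refine list_flatMap (list_range.comp (fst.comp (snd.comp (snd.comp fst)))) ?_
  refine list_map (list_range.comp (succ.comp (nat_mul.comp
    (fst.comp (fst.comp (snd.comp (fst.comp fst))))
    (fst.comp (snd.comp (snd.comp (fst.comp fst))))))) ?_
  exact pair (snd.comp (fst.comp fst)) (pair (snd.comp fst) snd)

theorem primrec_codeRefine : Primrec₂ codeRefine := by
  classical
  have h : PrimrecRel fun (t : ℕ × ℕ × ℕ) (e : (List ℕ × Code × Code) × List (ℕ × ℕ × ℕ)) =>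
      CodeStep e.1 e.2 t := primrecPred_codeStep.comp (pair snd fst)
  refine (h.listFilter.comp (snd (α := List ℕ × Code × Code)) Primrec.id).of_eq fun e => ?_
  exact List.filter_congr fun t _ => by simp

theorem primrec_codeSimulation : Primrec codeSimulation :=
  nat_iterate (list_length.comp primrec_codeTriples) primrec_codeTriples primrec_codeRefine

theorem primrecPred_codeCovers :
    PrimrecPred fun c : List ℕ × Code × Code => CodeCovers c (codeSimulation c) := by
  unfold CodeCovers
  refine PrimrecPred.forall_mem_comp (fst.comp (snd.comp (snd.comp (fst.comp snd)))) ?_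
  refine PrimrecPred.imp (nat_lt.comp snd (fst.comp (fst.comp (snd.comp fst)))) ?_
  refine PrimrecPred.exists_mem_comp
    (fst.comp (snd.comp (snd.comp (snd.comp (snd.comp fst))))) ?_
  refine PrimrecPred.exists_mem_comp (primrec_codeSimulation.comp (fst.comp fst)) ?_
  exact PrimrecPred.and (Primrec.eq.comp (fst.comp snd) (snd.comp (fst.comp fst)))
    (Primrec.eq.comp (fst.comp (snd.comp snd)) (snd.comp fst))

end Computability

/-! ### Correctness -/

theorem codeRefine_sublist (c : List ℕ × Code × Code) (L : List (ℕ × ℕ × ℕ)) :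
    (codeRefine c L).Sublist L := List.filter_sublist

theorem mem_codeTriples {c : List ℕ × Code × Code} {t : ℕ × ℕ × ℕ} : t ∈ codeTriples c ↔
    t.1 < c.2.1.1 ∧ t.2.1 < c.2.2.1 ∧ t.2.2 ≤ c.2.1.1 * c.2.2.1 := by
  obtain ⟨x, y, n⟩ := t
  simp [codeTriples]

theorem codeSimulation_subset (c : List ℕ × Code × Code) :
    codeSimulation c ⊆ codeTriples c := by
  unfold codeSimulation
  generalize (codeTriples c).length = n
  induction n with
  | zero => exact List.Subset.refl _
  | succ n ih =>
    rw [Function.iterate_succ_apply']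
    exact List.Subset.trans (codeRefine_sublist c _).subset ih

theorem codeStep_of_mem_codeSimulation {c : List ℕ × Code × Code} {t : ℕ × ℕ × ℕ}
    (ht : t ∈ codeSimulation c) : CodeStep c (codeSimulation c) t := by
  have hfix : codeRefine c (codeSimulation c) = codeSimulation c :=
    List.iterate_sublist_fixed (codeRefine_sublist c) _ le_rfl
  rw [← hfix] at ht
  simpa using List.of_mem_filter ht

/-- A family of triples that can always answer within any list containing it survives every
deletion; this is the maximality of the computed list. -/
theorem mem_codeSimulation {c : List ℕ × Code × Code} {P : ℕ × ℕ × ℕ → Prop}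
    (h0 : ∀ t, P t → t ∈ codeTriples c)
    (hstep : ∀ L : List (ℕ × ℕ × ℕ), (∀ t, P t → t ∈ L) → ∀ t, P t → CodeStep c L t)
    {t : ℕ × ℕ × ℕ} (ht : P t) : t ∈ codeSimulation c := by
  unfold codeSimulation
  generalize (codeTriples c).length = n
  induction n generalizing t with
  | zero => exact h0 t ht
  | succ n ih =>
    rw [Function.iterate_succ_apply']
    exact List.mem_filter.2 ⟨ih ht, by simpa using hstep _ (fun t => ih) t ht⟩

theorem codeCovers_of_rankedSimulation {c : List ℕ × Code × Code}
    {T : Set ((Fin c.2.1.1 × Fin c.2.2.1) × ℕ)}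
    (hT : IsRankedSimulation (ofCode c.1 c.2.1) (ofCode c.1 c.2.2) T)
    (hb : ∀ p ∈ T, p.2 ≤ c.2.1.1 * c.2.2.1) : CodeCovers c (codeSimulation c) := by
  have key : ∀ {t : ℕ × ℕ × ℕ}, (∃ p ∈ T, t = (p.1.1.val, p.1.2.val, p.2)) →
      t ∈ codeSimulation c := by
    intro t
    refine mem_codeSimulation (P := fun t => ∃ p ∈ T, t = (p.1.1.val, p.1.2.val, p.2)) ?_ ?_
    · rintro _ ⟨p, hp, rfl⟩
      exact mem_codeTriples.2 ⟨p.1.1.2, p.1.2.2, hb p hp⟩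
    -- The side conditions in `CodeStep` select exactly the listed transitions that fit the alphabet
    -- and the state count, so the code transition is a genuine `a`.
    · rintro L hL _ ⟨⟨⟨x, y⟩, n⟩, hp, rfl⟩ ⟨x', s, xs⟩ htr ⟨rfl, hs, hxs⟩
      obtain ⟨hs1, hs2⟩ := List.getElem?_eq_some_iff.1 hs
      have hxs' : ∀ i : Fin (c.1.get ⟨s, hs1⟩), i.1 < xs.length := fun i => hs2 ▸ i.2
      let a : Branching (fun s : Fin c.1.length => c.1.get s) (Fin c.2.1.1) :=
        ⟨⟨s, hs1⟩, fun i => ⟨xs[i.1]'(hxs' i), hxs _ (List.getElem_mem _)⟩⟩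
      have hof : List.ofFn (fun i => (a.2 i).val) = xs := by
        refine List.ext_getElem (by simpa [a] using hs2) fun i h1 h2 => ?_
        simp [a]
      have ha : a ∈ (ofCode c.1 c.2.1).δ x := by
        show (x.val, s, List.ofFn fun i => (a.2 i).val) ∈ c.2.1.2.1
        rw [hof]
        exact htr
      obtain ⟨ys, hys, hsucc⟩ := hT.step _ _ hp a ha
      have hlen : (List.ofFn fun i => (ys i).val).length = xs.length := by
        simpa [a] using hs2
      refine ⟨(y.val, s, List.ofFn fun i => (ys i).val), hys, rfl, rfl, hlen, fun i hi => ?_⟩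
      have hi : i < xs.length := List.mem_range.1 hi
      have hi' : i < c.1.get ⟨s, hs1⟩ := by rw [← hs2] at hi; exact hi
      obtain ⟨k, hk, hrank⟩ := hsucc ⟨i, hi'⟩
      refine ⟨_, hL _ ⟨_, hk, rfl⟩, ?_, ?_, hrank⟩
      · show xs[i] = xs.getD i 0
        rw [List.getD_eq_getElem _ _ hi]
      · show (ys ⟨i, hi'⟩).val = (List.ofFn fun i => (ys i).val).getD i 0
        rw [List.getD_eq_getElem _ _ (by rw [hlen]; exact hi), List.getElem_ofFn]
  intro x hx hxn
  obtain ⟨y, hy, n, hn⟩ := hT.covers ⟨x, hxn⟩ hx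
  exact ⟨y.val, hy, _, key ⟨_, hn, rfl⟩, rfl, rfl⟩

theorem rankedSimulation_of_codeCovers {c : List ℕ × Code × Code}
    (hc : CodeCovers c (codeSimulation c)) :
    IsRankedSimulation (ofCode c.1 c.2.1) (ofCode c.1 c.2.2)
      {p | (p.1.1.val, p.1.2.val, p.2) ∈ codeSimulation c} := by
  have hlt : ∀ {t}, t ∈ codeSimulation c → t.1 < c.2.1.1 ∧ t.2.1 < c.2.2.1 := fun h =>
    have h := mem_codeTriples.1 (codeSimulation_subset c h)
    ⟨h.1, h.2.1⟩
  refine ⟨?_, ?_⟩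
  · rintro ⟨x, y⟩ n hp ⟨s, xs⟩ ha
    have hlen : (List.ofFn fun i => (xs i).val).length = c.1.get s := List.length_ofFn
    obtain ⟨⟨y', s', ys⟩, htr, rfl, rfl, hys, hu⟩ := codeStep_of_mem_codeSimulation hp
      (x.val, s.val, List.ofFn fun i => (xs i).val) ha
      ⟨rfl, by
        show c.1[s.val]? = some (List.ofFn fun i => (xs i).val).length
        rw [hlen]
        simp, by
        intro e he
        obtain ⟨i, rfl⟩ := List.mem_ofFn.1 he
        exact (xs i).2⟩
    have hys : ys.length = c.1.get s := hys.trans hlen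
    have hu' : ∀ i : Fin (c.1.get s), ∃ k, ((xs i).val, ys.getD i 0, k) ∈ codeSimulation c ∧
        (y.val ∈ c.2.2.2.2.2 ∨ (k ≤ n ∧ (x.val ∈ c.2.1.2.2.2 → k < n))) := by
      intro i
      obtain ⟨⟨x', y', k⟩, hmem, hx', hy', hk⟩ := hu i.val (List.mem_range.2 (i.2.trans_eq hlen.symm))
      have hx'' : x' = (xs i).val := by
        refine hx'.trans ?_
        show (List.ofFn fun i => (xs i).val).getD i.val 0 = _
        rw [List.getD_eq_getElem _ _ (i.2.trans_eq hlen.symm), List.getElem_ofFn]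
      have hy'' : y' = ys.getD i.val 0 := hy'
      subst hx'' hy''
      exact ⟨k, hmem, hk⟩
    -- `CodeAnswer` does not check that the answering successors are states; this follows because
    -- they occur in listed triples.
    have hbound : ∀ i : Fin (c.1.get s), ys.getD i 0 < c.2.2.1 := fun i => by
      obtain ⟨k, hk, -⟩ := hu' i
      exact (hlt hk).2
    refine ⟨fun i => ⟨ys.getD i 0, hbound i⟩, ?_, hu'⟩
    show (y.val, s.val, List.ofFn fun i : Fin (c.1.get s) => ys.getD i 0) ∈ c.2.2.2.1
    have hof : (List.ofFn fun i : Fin (c.1.get s) => ys.getD i 0) = ys := by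
      refine List.ext_getElem (by rw [List.length_ofFn, hys]) fun i h1 h2 => ?_
      rw [List.getElem_ofFn, List.getD_eq_getElem _ _ h2]
    rw [hof]
    exact htr
  · intro x hx
    obtain ⟨y, hy, ⟨x', y', n⟩, hu, hx', hy'⟩ := hc x.val hx x.2
    have hx'' : x' = x.val := hx'
    have hy'' : y' = y := hy'
    subst hx'' hy''
    exact ⟨⟨y', (hlt hu).2⟩, hy, n, hu⟩

end NBTA

theorem proposition3p13 :
    (∀ {S : Type u} (ar : S → ℕ) {X : Type v} {Y : Type w} [Finite X] [Finite Y]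
      (A : NBTA ar X) (B : NBTA ar Y),
      ((∃ R : Set (X × Y), NBTA.IsFairSimulation A B R) ↔
        (NBTA.simGame A B).EvenWins NBTA.SimPosition.start) ∧
      ((∃ R : Set (X × Y), NBTA.IsFairSimulation A B R) → A.language ⊆ B.language)) ∧
    ComputablePred (fun c : List ℕ × NBTA.Code × NBTA.Code =>
      ∃ R : Set (Fin c.2.1.1 × Fin c.2.2.1),
        NBTA.IsFairSimulation (NBTA.ofCode c.1 c.2.1) (NBTA.ofCode c.1 c.2.2) R) := by
  refine ⟨fun ar X Y _ _ A B => ⟨⟨?_, NBTA.exists_isFairSimulation_of_evenWins⟩, ?_⟩, ?_⟩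
  · rintro ⟨R, hR⟩
    obtain ⟨T, hT, -⟩ := hR.exists_rankedSimulation
    exact hT.evenWins
  · rintro ⟨R, hR⟩
    obtain ⟨T, hT, -⟩ := hR.exists_rankedSimulation
    exact hT.language_subset
  -- The computed list gives a ranked simulation, and the game leads from there back to a fair
  -- simulation; conversely the rank bound places every fair simulation within the finite search
  -- space.
  · refine NBTA.primrecPred_codeCovers.computablePred.of_eq fun c => ⟨fun hc => ?_, ?_⟩
    · exact NBTA.exists_isFairSimulation_of_evenWins
        (NBTA.rankedSimulation_of_codeCovers hc).evenWins
    · rintro ⟨R, hR⟩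
      obtain ⟨T, hT, hb⟩ := hR.exists_rankedSimulation
      exact NBTA.codeCovers_of_rankedSimulation hT (by simpa using hb)
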